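/- Let $n\ge 0$ and let $G_{\mathbb R}$ be a closed subgroup of $\mathrm{GL}_n(\mathbb C)$ that is connected and non-compact, and let $$\mathfrak g_{\mathbb R}=\{X\in M_n(\mathbb C)\;:\;\exp(tX)\in G_{\mathbb R}\text{ for all }t\in\mathbb R\}$$ be its (real) Lie algebra. Assume that $G_{\mathbb R}$ is simple, i.e. that the real Lie algebra $\mathfrak g_{\mathbb R}$ is simple (non-abelian, with no ideals other than $0$ and $\mathfrak g_{\mathbb R}$). For $x\in\mathfrak g_{\mathbb R}$ write $G_{\mathbb R}\cdot x=\{gxg^{-1}: g\in G_{\mathbb R}\}$ for its adjoint orbit, and define $$\lim_{\nu\to0^+}G_{\mathbb R}\cdot(\nu x):=\bigcap_{\epsilon>0}\overline{\bigcup_{\nu\in(0,\epsilon)}G_{\mathbb R}\cdot(\nu x)},$$ the closure being taken in $\mathfrak g_{\mathbb R}$ with its usual (Euclidean) topology. Then, for every nonzero $x\in\mathfrak g_{\mathbb R}$, $$\lim_{\nu\to 0^+}G_{\mathbb R}\cdot(\nu x)\neq\{0\}.$$ -/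

import Mathlib

open scoped Topology

attribute [local instance] LieRing.ofAssociativeRing

namespace LinearGroup

/-- In a real Banach algebra, a closed subgroup `G` of the group of units contains `exp Z` as soon as
`Z` is the velocity at `1` of a curve with values in `G`. -/
theorem exists_mem_eq_exp_of_hasDerivAt {A : Type*} [NormedRing A] [NormedAlgebra ℝ A]
    [CompleteSpace A] (G : Subgroup Aˣ) (hG : IsClosed (G : Set Aˣ)) (γ : ℝ → A) (Z : A)
    (hγ : ∀ t, ∃ g ∈ G, (g : A) = γ t) (h0 : γ 0 = 1) (hd : HasDerivAt γ Z 0) :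
    ∃ g ∈ G, (g : A) = NormedSpace.exp Z := by
  let _ : NormedAlgebra ℚ A := NormedAlgebra.restrictScalars ℚ ℝ A
  have hexp : HasStrictFDerivAt (NormedSpace.exp : A → A)
      ((ContinuousLinearEquiv.refl ℝ A : A ≃L[ℝ] A) : A →L[ℝ] A) 0 := by
    exact hasStrictFDerivAt_exp_zero (𝕂 := ℝ) (𝔸 := A)
  set L : A → A := hexp.localInverse with hL
  have hL1 : HasStrictFDerivAt L (ContinuousLinearMap.id ℝ A) 1 := by
    simpa using hexp.to_localInverse
  have hL0 : L 1 = 0 := by simpa using hexp.localInverse_apply_image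
  have hright : ∀ᶠ y in 𝓝 (1 : A), NormedSpace.exp (L y) = y := by
    simpa using hexp.eventually_right_inverse
  have hLγ : HasDerivAt (fun t => L (γ t)) Z 0 := by
    have h1 : HasFDerivAt L (ContinuousLinearMap.id ℝ A) (γ 0) := by
      rw [h0]; exact hL1.hasFDerivAt
    exact h1.comp_hasDerivAt (0 : ℝ) hd
  have hseq : Filter.Tendsto (fun k : ℕ => ((k : ℝ) + 1)⁻¹) Filter.atTop (𝓝[≠] 0) := by
    rw [tendsto_nhdsWithin_iff]
    refine ⟨?_, Filter.Eventually.of_forall fun k => ?_⟩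
    · simpa using tendsto_one_div_add_atTop_nhds_zero_nat (𝕜 := ℝ)
    · simp only [Set.mem_compl_iff, Set.mem_singleton_iff]
      positivity
  have hlim : Filter.Tendsto (fun k : ℕ => (k + 1) • L (γ ((k : ℝ) + 1)⁻¹)) Filter.atTop (𝓝 Z) := by
    have := (hasDerivAt_iff_tendsto_slope.1 hLγ).comp hseq
    refine this.congr fun k => ?_
    simp only [Function.comp, slope, h0, hL0, sub_zero, inv_inv, vsub_eq_sub]
    rw [← Nat.cast_smul_eq_nsmul ℝ]
    push_cast
    rfl
  have hexplim : Filter.Tendsto (fun k : ℕ => NormedSpace.exp ((k + 1) • L (γ ((k : ℝ) + 1)⁻¹)))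
      Filter.atTop (𝓝 (NormedSpace.exp Z)) :=
    ((NormedSpace.exp_continuous (𝔸 := A)).tendsto Z).comp hlim
  have hγlim : Filter.Tendsto (fun k : ℕ => γ ((k : ℝ) + 1)⁻¹) Filter.atTop (𝓝 1) := by
    rw [← h0]
    exact hd.continuousAt.tendsto.comp (hseq.mono_right nhdsWithin_le_nhds)
  choose g hgG hg using hγ
  have hpow : Filter.Tendsto (fun k : ℕ => ((g ((k : ℝ) + 1)⁻¹ ^ (k + 1) : Aˣ) : A))
      Filter.atTop (𝓝 (NormedSpace.exp Z)) := by
    refine hexplim.congr' ?_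
    filter_upwards [hγlim.eventually hright] with k hk
    rw [NormedSpace.exp_nsmul, hk, Units.val_pow_eq_pow_val, hg]
  obtain ⟨u, hu⟩ : IsUnit (NormedSpace.exp Z) := NormedSpace.isUnit_exp Z
  refine ⟨u, ?_, hu⟩
  rw [← hu] at hpow
  have hu' := (Units.isOpenEmbedding_val (R := A)).isEmbedding.tendsto_nhds_iff.2 hpow
  exact hG.mem_of_tendsto hu' (Filter.Eventually.of_forall fun k => G.pow_mem (hgG _) _)

/-- The generators of the one-parameter subgroups contained in `G`. -/
def oneParam {A : Type*} [Ring A] [TopologicalSpace A] [IsTopologicalRing A] [Algebra ℝ A]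
    (G : Subgroup Aˣ) : Set A :=
  {X | ∀ t : ℝ, ∃ g ∈ G, (g : A) = NormedSpace.exp (t • X)}

section Closure

variable {A : Type*} [NormedRing A] [NormedAlgebra ℝ A] (G : Subgroup Aˣ)

theorem zero_mem_oneParam : (0 : A) ∈ oneParam G := fun t =>
  ⟨1, G.one_mem, by simp⟩

theorem smul_mem_oneParam (c : ℝ) {X : A} (hX : X ∈ oneParam G) : c • X ∈ oneParam G := fun t => by
  simpa [smul_smul] using hX (t * c)

variable [CompleteSpace A]

theorem conj_mem_oneParam {g : Aˣ} (hg : g ∈ G) {X : A} (hX : X ∈ oneParam G) :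
    (g : A) * X * ((g⁻¹ : Aˣ) : A) ∈ oneParam G := fun t => by
  let _ : NormedAlgebra ℚ A := NormedAlgebra.restrictScalars ℚ ℝ A
  obtain ⟨u, hu, hut⟩ := hX t
  refine ⟨g * u * g⁻¹, G.mul_mem (G.mul_mem hg hu) (G.inv_mem hg), ?_⟩
  rw [← smul_mul_assoc, ← mul_smul_comm, NormedSpace.exp_units_conj, ← hut]
  simp

theorem add_mem_oneParam (hG : IsClosed (G : Set Aˣ)) {X Y : A} (hX : X ∈ oneParam G)
    (hY : Y ∈ oneParam G) : X + Y ∈ oneParam G := fun t => by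
  refine exists_mem_eq_exp_of_hasDerivAt G hG
    (fun s => NormedSpace.exp (s • (t • X)) * NormedSpace.exp (s • (t • Y))) _ (fun s => ?_) ?_ ?_
  · obtain ⟨u, hu, hus⟩ := smul_mem_oneParam G t hX s
    obtain ⟨v, hv, hvs⟩ := smul_mem_oneParam G t hY s
    exact ⟨u * v, G.mul_mem hu hv, by simp [hus, hvs]⟩
  · simp
  · have h := (hasDerivAt_exp_smul_const (𝕂 := ℝ) (t • X) (0 : ℝ)).mul
      (hasDerivAt_exp_smul_const (𝕂 := ℝ) (t • Y) (0 : ℝ))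
    refine h.congr_deriv ?_
    simp [smul_add]

theorem isClosed_oneParam (hG : IsClosed (G : Set Aˣ)) : IsClosed (oneParam G) := by
  let _ : NormedAlgebra ℚ A := NormedAlgebra.restrictScalars ℚ ℝ A
  rw [← isSeqClosed_iff_isClosed]
  intro X Z hX hZ t
  choose g hgG hg using fun k => hX k t
  obtain ⟨u, hu⟩ : IsUnit (NormedSpace.exp (t • Z)) := NormedSpace.isUnit_exp _
  refine ⟨u, ?_, hu⟩
  have h : Filter.Tendsto (fun k => (g k : A)) Filter.atTop (𝓝 (u : A)) := by
    simp only [hg, hu]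
    exact ((NormedSpace.exp_continuous (𝔸 := A)).tendsto _).comp (hZ.const_smul t)
  have hu' := (Units.isOpenEmbedding_val (R := A)).isEmbedding.tendsto_nhds_iff.2 h
  exact hG.mem_of_tendsto hu' (Filter.Eventually.of_forall hgG)

theorem lie_mem_oneParam (hG : IsClosed (G : Set Aˣ)) {X Y : A} (hX : X ∈ oneParam G)
    (hY : Y ∈ oneParam G) : X * Y - Y * X ∈ oneParam G := by
  let _ : NormedAlgebra ℚ A := NormedAlgebra.restrictScalars ℚ ℝ A
  have hd : HasDerivAt (fun s : ℝ => NormedSpace.exp (s • X) * Y * NormedSpace.exp (s • (-X)))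
      (X * Y - Y * X) 0 := by
    have h := ((hasDerivAt_exp_smul_const (𝕂 := ℝ) X (0 : ℝ)).mul_const Y).mul
      (hasDerivAt_exp_smul_const (𝕂 := ℝ) (-X) (0 : ℝ))
    refine h.congr_deriv ?_
    simp [sub_eq_add_neg]
  have hmem : ∀ s : ℝ, NormedSpace.exp (s • X) * Y * NormedSpace.exp (s • (-X)) ∈ oneParam G := by
    intro s
    obtain ⟨u, hu, hus⟩ := hX s
    have hinv : ((u⁻¹ : Aˣ) : A) = NormedSpace.exp (s • (-X)) := by
      rw [Units.inv_eq_of_mul_eq_one_right]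
      rw [hus, ← NormedSpace.exp_add_of_commute (by simp [Commute, SemiconjBy])]
      simp
    rw [← hus, ← hinv]
    exact conj_mem_oneParam G hu hY
  refine (isClosed_oneParam G hG).mem_of_tendsto (hasDerivAt_iff_tendsto_slope.1 hd)
    (Filter.Eventually.of_forall fun s => ?_)
  simp only [slope, vsub_eq_sub]
  refine smul_mem_oneParam G _ ?_
  have h := add_mem_oneParam G hG (hmem s) (smul_mem_oneParam G (-1) (hmem 0))
  rwa [neg_one_smul, ← sub_eq_add_neg] at h

end Closure

/-- The Lie algebra of a closed subgroup `G` of `GL_n(ℂ)`: the real Lie algebra of all complex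
matrices `X` with `exp (t X) ∈ G` for every real `t`, with the bracket `X * Y - Y * X`. -/
def lieAlgebra {n : ℕ} (G : Subgroup (GL (Fin n) ℂ)) (hG : IsClosed (G : Set (GL (Fin n) ℂ))) :
    LieSubalgebra ℝ (Matrix (Fin n) (Fin n) ℂ) where
  carrier := {X | ∀ t : ℝ, ∃ g ∈ G, (g : Matrix (Fin n) (Fin n) ℂ) = NormedSpace.exp (t • X)}
  zero_mem' := open scoped Matrix.Norms.Operator in zero_mem_oneParam G
  add_mem' := open scoped Matrix.Norms.Operator in add_mem_oneParam G hG
  smul_mem' := open scoped Matrix.Norms.Operator in fun c _ hX => smul_mem_oneParam G c hX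
  lie_mem' := open scoped Matrix.Norms.Operator in fun hX hY => lie_mem_oneParam G hG hX hY

/-- The adjoint action of `g ∈ G` on the Lie algebra of `G`: `Ad(g) X = g X g⁻¹`. -/
def adjoint {n : ℕ} {G : Subgroup (GL (Fin n) ℂ)} (hG : IsClosed (G : Set (GL (Fin n) ℂ)))
    (g : G) (X : lieAlgebra G hG) : lieAlgebra G hG :=
  ⟨((g : GL (Fin n) ℂ) : Matrix (Fin n) (Fin n) ℂ) * (X : Matrix (Fin n) (Fin n) ℂ) *
      (((g : GL (Fin n) ℂ)⁻¹ : GL (Fin n) ℂ) : Matrix (Fin n) (Fin n) ℂ),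
    open scoped Matrix.Norms.Operator in conj_mem_oneParam G g.2 X.2⟩

/-- The adjoint orbit `G · X` in the Lie algebra of `G`. -/
def adjointOrbit {n : ℕ} {G : Subgroup (GL (Fin n) ℂ)} (hG : IsClosed (G : Set (GL (Fin n) ℂ)))
    (X : lieAlgebra G hG) : Set (lieAlgebra G hG) :=
  Set.range fun g : G => adjoint hG g X

/-- The limit `lim_{ν → 0⁺} G · (ν X)`: the intersection over `ε > 0` of the closures, in the Lie
algebra of `G` with its usual topology, of the unions of the orbits `G · (ν X)`, `0 < ν < ε`. -/
def orbitLimit {n : ℕ} {G : Subgroup (GL (Fin n) ℂ)} (hG : IsClosed (G : Set (GL (Fin n) ℂ)))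
    (X : lieAlgebra G hG) : Set (lieAlgebra G hG) :=
  ⋂ ε : ℝ, ⋂ _ : 0 < ε, closure (⋃ ν ∈ Set.Ioo (0 : ℝ) ε, adjointOrbit hG (ν • X))

end LinearGroup

/-! The argument is by contradiction: if the limit is `{0}`, then `G` is compact.

Bounded orbits. If the orbit of `x` were unbounded, orbit points divided by their norms would
accumulate at a unit vector of the limit; so the orbit is bounded
(`mem_boundedOrbitSubmodule_of_orbitLimit_eq`). The elements with bounded orbit form an ideal, which
by simplicity is the whole Lie algebra 𝔤, and `Ad G` is bounded.

Reduction to the centre. All derivations of 𝔤 are inner, so Cartan's closed subgroup theorem in the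
automorphism group of 𝔤 shows that an element with adjoint action near the identity acts as `exp Y`
with `Y` in 𝔤 bounded. Covering `Ad G` by finitely many small balls gives `G` = (bounded set) ·
(centre) (`exists_bound_mul_center`).

The centre is bounded (`exists_norm_centerMatrices_le`). Since 𝔤 = [𝔤, 𝔤], the determinant of `G` on
each generalised eigenspace of a central `z` is 1; hence the eigenvalues of `z` have modulus 1 and
its trace has modulus at most `n`. These traces control `z` itself because the trace form is
nondegenerate on the span of the centre, which follows from M_n(ℂ) = (centralizer of 𝔤) + [𝔤,
M_n(ℂ)].

A bounded closed subgroup is compact, which is excluded. -/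

section

/-! ### Modules over a simple Lie algebra: the Casimir operator and the splitting off of invariants.
-/

open LieModule Module

variable {K L M : Type*} [Field K] [LieRing L] [LieAlgebra K L]
  [AddCommGroup M] [Module K M] [LieRingModule L M] [LieModule K L M]

theorem LieAlgebra.IsSimple.lie_top_top [LieAlgebra.IsSimple K L] :
    ⁅(⊤ : LieIdeal K L), (⊤ : LieIdeal K L)⁆ = ⊤ := by
  refine (LieAlgebra.IsSimple.eq_bot_or_eq_top (R := K) _).resolve_left fun h => ?_
  refine LieAlgebra.IsSimple.non_abelian (R := K) (L := L) ⟨fun x y => ?_⟩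
  exact (LieSubmodule.lie_eq_bot_iff _ _).1 h x trivial y trivial

/-- By perfectness it suffices to act by a bracket, and [a, b]m = a(bm) − b(am) is a sum of double
actions. -/
theorem LieSubmodule.top_lie_le_of_perfect (hL : ⁅(⊤ : LieIdeal K L), (⊤ : LieIdeal K L)⁆ = ⊤)
    (N : LieSubmodule K L M) :
    ⁅(⊤ : LieIdeal K L), N⁆ ≤ ⁅(⊤ : LieIdeal K L), ⁅(⊤ : LieIdeal K L), N⁆⁆ := by
  rw [LieSubmodule.lieIdeal_oper_eq_span, LieSubmodule.lieSpan_le]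
  rintro _ ⟨⟨x, hx⟩, ⟨m, hm⟩, rfl⟩
  rw [← hL, ← LieSubmodule.mem_toSubmodule, LieSubmodule.lieIdeal_oper_eq_linear_span] at hx
  change ⁅x, m⁆ ∈ _
  induction hx using Submodule.span_induction with
  | mem y hy =>
    obtain ⟨⟨a, -⟩, ⟨b, -⟩, rfl⟩ := hy
    change ⁅⁅a, b⁆, m⁆ ∈ _
    rw [lie_lie]
    have h : ∀ a b : L, ⁅a, ⁅b, m⁆⁆ ∈ ⁅(⊤ : LieIdeal K L), ⁅(⊤ : LieIdeal K L), N⁆⁆ := fun a b =>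
      LieSubmodule.lie_mem_lie trivial (LieSubmodule.lie_mem_lie trivial hm)
    exact sub_mem (h a b) (h b a)
  | zero => simp
  | add y z _ _ hy hz => rw [add_lie]; exact add_mem (hy trivial) (hz trivial)
  | smul c y _ hy => rw [smul_lie]; exact SMulMemClass.smul_mem c (hy trivial)

/-- A nilpotent module over a perfect Lie algebra is trivial. -/
theorem LieModule.maxTrivSubmodule_eq_top_of_perfect [LieModule.IsNilpotent L M]
    (hL : ⁅(⊤ : LieIdeal K L), (⊤ : LieIdeal K L)⁆ = ⊤) : maxTrivSubmodule K L M = ⊤ := by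
  -- The lower central series is stationary from index 1 on, so its eventual vanishing already kills
  -- LM.
  have hk : ∀ k : ℕ, ⁅(⊤ : LieIdeal K L), (⊤ : LieSubmodule K L M)⁆ ≤
      lowerCentralSeries K L M (k + 1) := by
    intro k
    induction k with
    | zero => simp
    | succ k ih =>
      refine (LieSubmodule.top_lie_le_of_perfect hL _).trans ?_
      rw [lowerCentralSeries_succ]
      exact LieSubmodule.mono_lie_right _ ih
  obtain ⟨k, h⟩ := LieModule.IsNilpotent.nilpotent K L M
  rw [← top_le_iff, LieModule.le_max_triv_iff_bracket_eq_bot, ← le_bot_iff, ← h]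
  refine (hk k).trans (LieModule.antitone_lowerCentralSeries K L M (Nat.le_succ k))

variable [FiniteDimensional K L]

/-- The Casimir operator of a module attached to a nondegenerate symmetric bilinear form. -/
noncomputable def LieModule.casimir (B : LinearMap.BilinForm K L) (hB : B.Nondegenerate)
    (M : Type*) [AddCommGroup M] [Module K M] [LieRingModule L M] [LieModule K L M] : End K M :=
  ∑ i, toEnd K L M (finBasis K L i) * toEnd K L M (B.dualBasis hB (finBasis K L) i)

/-- Invariance of `B` makes the matrix of ad x in the basis `b` the negative transpose of its matrix
in the dual basis `d`; the two sums in the commutator with the Casimir operator therefore cancel. -/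
theorem LieModule.commute_casimir (B : LinearMap.BilinForm K L) (hB : B.Nondegenerate)
    (hs : B.IsSymm) (hinv : ∀ x y z : L, B ⁅x, y⁆ z = - B y ⁅x, z⁆) (x : L) :
    Commute (toEnd K L M x) (casimir B hB M) := by
  set b := finBasis K L
  set d := B.dualBasis hB b
  set φ := toEnd K L M
  have hbe : ∀ y : L, y = ∑ j, B y (d j) • b j := fun y => by
    have h := (B.dualBasis hB d).sum_repr y
    simp only [LinearMap.BilinForm.dualBasis_repr_apply] at h
    conv_lhs => rw [← h]
    simp only [d, LinearMap.BilinForm.dualBasis_dualBasis hB hs]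
  have hde : ∀ y : L, y = ∑ j, B y (b j) • d j := fun y => by
    have h := d.sum_repr y
    simp only [d, LinearMap.BilinForm.dualBasis_repr_apply] at h
    conv_lhs => rw [← h]
  have h1 : ∑ i, φ ⁅x, b i⁆ * φ (d i) = ∑ i, ∑ j, B ⁅x, b i⁆ (d j) • (φ (b j) * φ (d i)) := by
    refine Finset.sum_congr rfl fun i _ => ?_
    conv_lhs => rw [hbe ⁅x, b i⁆]
    simp [Finset.sum_mul]
  have h2 : ∑ i, φ (b i) * φ ⁅x, d i⁆ = - ∑ i, ∑ j, B ⁅x, b i⁆ (d j) • (φ (b j) * φ (d i)) := by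
    rw [Finset.sum_comm, ← Finset.sum_neg_distrib]
    refine Finset.sum_congr rfl fun i _ => ?_
    conv_lhs => rw [hde ⁅x, d i⁆]
    simp only [map_sum, map_smul, Finset.mul_sum, mul_smul_comm, ← Finset.sum_neg_distrib,
      ← neg_smul]
    refine Finset.sum_congr rfl fun j _ => ?_
    rw [hinv x (b j), neg_neg, hs.eq]
  have h3 : φ x * casimir B hB M - casimir B hB M * φ x = 0 := by
    have : φ x * casimir B hB M - casimir B hB M * φ x =
        ∑ i, φ ⁅x, b i⁆ * φ (d i) + ∑ i, φ (b i) * φ ⁅x, d i⁆ := by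
      simp only [casimir, Finset.mul_sum, Finset.sum_mul, ← Finset.sum_sub_distrib,
        ← Finset.sum_add_distrib]
      refine Finset.sum_congr rfl fun i _ => ?_
      simp only [φ, LieHom.map_lie, Ring.lie_def]
      noncomm_ring
    rw [this, h1, h2, add_neg_cancel]
  exact sub_eq_zero.1 h3

/-- The kernel of an invariant form is an ideal. -/
theorem LieModule.traceForm_eq_zero_or_nondegenerate [LieAlgebra.IsSimple K L] :
    traceForm K L M = 0 ∨ (traceForm K L M).Nondegenerate := by
  let I : LieIdeal K L :=
    { LinearMap.ker (traceForm K L M) with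
      lie_mem := fun {x m} hm => by
        change traceForm K L M ⁅x, m⁆ = 0
        ext z
        have hm' : traceForm K L M m = 0 := hm
        rw [traceForm_apply_lie_apply', hm']
        simp }
  rcases LieAlgebra.IsSimple.eq_bot_or_eq_top (R := K) I with h | h
  · right
    have hker : LinearMap.ker (traceForm K L M) = ⊥ := by
      simpa [I] using congrArg LieSubmodule.toSubmodule h
    exact LinearMap.BilinForm.nondegenerate_iff_ker_eq_bot.2 hker
  · left
    ext x y
    have : x ∈ I := h ▸ trivial
    have h' : traceForm K L M x = 0 := this
    simp [h']

/-- A finite-dimensional module over a simple Lie algebra in characteristic zero is the sum of its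
invariants and of the span of the brackets. -/
theorem LieModule.maxTrivSubmodule_sup_lie_top [CharZero K] [FiniteDimensional K M]
    [LieAlgebra.IsSimple K L] :
    maxTrivSubmodule K L M ⊔ ⁅(⊤ : LieIdeal K L), (⊤ : LieSubmodule K L M)⁆ = ⊤ := by
  induction hn : finrank K M using Nat.strong_induction_on generalizing M with
  | _ n ih =>
  subst hn
  have hL := LieAlgebra.IsSimple.lie_top_top (K := K) (L := L)
  rcases traceForm_eq_zero_or_nondegenerate (K := K) (L := L) (M := M) with h0 | hB
  · have hnil := isNilpotent_derivedSeries_of_traceForm_eq_zero h0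
    have : LieModule.IsNilpotent L M := by
      rw [LieModule.isNilpotent_iff_forall' (R := K)] at hnil ⊢
      intro x
      refine hnil ⟨x, ?_⟩
      simp [hL]
    rw [maxTrivSubmodule_eq_top_of_perfect hL, top_sup_eq]
  · have hs : (traceForm K L M).IsSymm := ⟨traceForm_comm K L M⟩
    have hcomm := commute_casimir (M := M) _ hB hs (traceForm_apply_lie_apply' K L M)
    set Ω := casimir _ hB M with hΩ
    -- Each pair of dual basis vectors contributes 1 to the trace. As dim L ≠ 0 in characteristic
    -- zero, `Ω` is not nilpotent.
    have htr : LinearMap.trace K M Ω = finrank K L := by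
      rw [hΩ, casimir, map_sum]
      have : ∀ i, LinearMap.trace K M (toEnd K L M (finBasis K L i) *
          toEnd K L M ((traceForm K L M).dualBasis hB (finBasis K L) i)) = 1 := fun i => by
        have := LinearMap.BilinForm.apply_dualBasis_right hB hs (finBasis K L) i i
        rwa [if_pos rfl] at this
      simp [this]
    -- Fitting decomposition of `Ω`: the null component `N` is a submodule because `Ω` commutes with
    -- `L`, and it is proper because `Ω` is not nilpotent, so induction applies to it. The
    -- complementary component lies in the range of `Ω`, hence in LM.
    let N : LieSubmodule K L M :=
      { (⨆ k, LinearMap.ker (Ω ^ k)) with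
        lie_mem := fun {x m} hm => by
          change m ∈ ⨆ k, LinearMap.ker (Ω ^ k) at hm
          change ⁅x, m⁆ ∈ ⨆ k, LinearMap.ker (Ω ^ k)
          have hmono : Directed (· ≤ ·) fun k => LinearMap.ker (Ω ^ k) :=
            (Ω.iterateKer.monotone).directed_le
          rw [Submodule.mem_iSup_of_directed _ hmono] at hm ⊢
          obtain ⟨k, hk⟩ := hm
          refine ⟨k, ?_⟩
          rw [LinearMap.mem_ker] at hk ⊢
          have := congrArg (fun f : End K M => f m) ((hcomm x).pow_right k).eq
          simp only [Module.End.mul_apply, hk, map_zero, toEnd_apply_apply] at this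
          exact this.symm }
    have hNsub : (N : Submodule K M) = ⨆ k, LinearMap.ker (Ω ^ k) := rfl
    have hcompl := Ω.isCompl_iSup_ker_pow_iInf_range_pow
    have hrange : (⨅ k, LinearMap.range (Ω ^ k)) ≤
        (⁅(⊤ : LieIdeal K L), (⊤ : LieSubmodule K L M)⁆ : LieSubmodule K L M).toSubmodule := by
      refine (iInf_le _ 1).trans ?_
      rintro _ ⟨m, rfl⟩
      rw [pow_one, hΩ, casimir, LinearMap.sum_apply]
      refine Submodule.sum_mem _ fun i _ => ?_
      exact LieSubmodule.lie_mem_lie trivial trivial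
    have hNtop : N ≠ ⊤ := by
      intro hN
      have hnil : _root_.IsNilpotent Ω := by
        have h1 : (⨆ k, LinearMap.ker (Ω ^ k)) = ⊤ := by rw [← hNsub, hN]; rfl
        rw [Module.End.isNilpotent_iff_of_finite]
        intro m
        have hm : m ∈ ⨆ k, LinearMap.ker (Ω ^ k) := h1 ▸ trivial
        have hmono : Directed (· ≤ ·) fun k => LinearMap.ker (Ω ^ k) :=
          (Ω.iterateKer.monotone).directed_le
        rwa [Submodule.mem_iSup_of_directed _ hmono] at hm
      have h0 := (LinearMap.isNilpotent_trace_of_isNilpotent hnil).eq_zero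
      rw [htr, Nat.cast_eq_zero] at h0
      have := LieAlgebra.IsSimple.nontrivial K L
      exact (finrank_pos (R := K) (M := L)).ne' h0
    have hlt : finrank K N < finrank K M := by
      refine Submodule.finrank_lt (s := N.toSubmodule) ?_
      exact fun h => hNtop (LieSubmodule.toSubmodule_injective h)
    have hN := ih _ hlt (M := N) rfl
    have hNle : N ≤ maxTrivSubmodule K L M ⊔ ⁅(⊤ : LieIdeal K L), (⊤ : LieSubmodule K L M)⁆ := by
      have h1 := congrArg (LieSubmodule.map N.incl) hN
      rw [LieSubmodule.map_sup] at h1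
      have h2 : N ≤ (⊤ : LieSubmodule K L N).map N.incl := fun m hm => ⟨⟨m, hm⟩, trivial, rfl⟩
      rw [← h1] at h2
      refine h2.trans (sup_le_sup ?_ ?_)
      · rintro _ ⟨y, hy, rfl⟩ x
        exact congrArg Subtype.val (hy x)
      · rw [LieSubmodule.map_bracket_eq]
        exact LieSubmodule.mono_lie_right _ le_top
    rw [← top_le_iff, ← LieSubmodule.toSubmodule_le_toSubmodule, LieSubmodule.top_toSubmodule,
      ← hcompl.sup_eq_top]
    refine sup_le ?_ ?_
    · rw [← hNsub, LieSubmodule.toSubmodule_le_toSubmodule]; exact hNle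
    · exact hrange.trans (LieSubmodule.toSubmodule_le_toSubmodule _ _ |>.2 le_sup_right)

end

namespace LinearGroup

/-! ### Cartan's closed subgroup theorem. -/

section ClosedSubgroup

variable {A : Type*} [NormedRing A] [NormedAlgebra ℝ A] [CompleteSpace A]

theorem exp_add_smul (s t : ℝ) (X : A) :
    NormedSpace.exp ((s + t) • X) = NormedSpace.exp (s • X) * NormedSpace.exp (t • X) := by
  let _ : NormedAlgebra ℚ A := NormedAlgebra.restrictScalars ℚ ℝ A
  rw [add_smul, NormedSpace.exp_add_of_commute]
  exact ((Commute.refl X).smul_left s).smul_right t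

theorem exp_mul_exp_neg (X : A) : NormedSpace.exp X * NormedSpace.exp (-X) = 1 := by
  simpa using (exp_add_smul 1 (-1) X).symm

theorem exp_neg_mul_exp (X : A) : NormedSpace.exp (-X) * NormedSpace.exp X = 1 := by
  simpa using (exp_add_smul (-1) 1 X).symm

theorem inv_eq_exp_neg {u : Aˣ} {X : A} (h : (u : A) = NormedSpace.exp X) :
    ((u⁻¹ : Aˣ) : A) = NormedSpace.exp (-X) := by
  rw [Units.inv_eq_of_mul_eq_one_right]
  rw [h, exp_mul_exp_neg]

/-- The times at which the one-parameter group generated by `X` lies in `H`. -/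
def expTimes (H : Subgroup Aˣ) (X : A) : AddSubgroup ℝ where
  carrier := {t | ∃ u ∈ H, (u : A) = NormedSpace.exp (t • X)}
  zero_mem' := ⟨1, H.one_mem, by simp⟩
  add_mem' := by
    rintro s t ⟨u, hu, hus⟩ ⟨v, hv, hvt⟩
    exact ⟨u * v, H.mul_mem hu hv, by rw [exp_add_smul, ← hus, ← hvt, Units.val_mul]⟩
  neg_mem' := by
    rintro t ⟨u, hu, hut⟩
    exact ⟨u⁻¹, H.inv_mem hu, by rw [neg_smul, inv_eq_exp_neg hut]⟩

theorem exists_mem_eq_exp_of_tendsto {H : Subgroup Aˣ} (hH : IsClosed (H : Set Aˣ)) {X : ℕ → A}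
    {Z : A} (hX : ∀ k, ∃ u ∈ H, (u : A) = NormedSpace.exp (X k))
    (hZ : Filter.Tendsto X Filter.atTop (𝓝 Z)) : ∃ u ∈ H, (u : A) = NormedSpace.exp Z := by
  let _ : NormedAlgebra ℚ A := NormedAlgebra.restrictScalars ℚ ℝ A
  choose g hgG hg using hX
  obtain ⟨u, hu⟩ : IsUnit (NormedSpace.exp Z) := NormedSpace.isUnit_exp _
  refine ⟨u, ?_, hu⟩
  have h : Filter.Tendsto (fun k => (g k : A)) Filter.atTop (𝓝 (u : A)) := by
    simp only [hg, hu]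
    exact ((NormedSpace.exp_continuous (𝔸 := A)).tendsto _).comp hZ
  have hu' := (Units.isOpenEmbedding_val (R := A)).isEmbedding.tendsto_nhds_iff.2 h
  exact hH.mem_of_tendsto hu' (Filter.Eventually.of_forall hgG)

/-- The Lie algebra of a closed subgroup of the units of a Banach algebra, as a subspace. -/
def oneParamSubmodule (H : Subgroup Aˣ) (hH : IsClosed (H : Set Aˣ)) : Submodule ℝ A where
  carrier := oneParam H
  zero_mem' := zero_mem_oneParam H
  add_mem' := add_mem_oneParam H hH
  smul_mem' := fun c _ hX => smul_mem_oneParam H c hX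

variable [FiniteDimensional ℝ A]

/-- Suppose nonzero Y_k → 0 in `m` have exponentials in `H`, and let W be a limit of the directions
Y_k / ‖Y_k‖. The integer multiples ⌊t / ‖Y_k‖⌋ Y_k tend to tW and still exponentiate into `H`, so
the unit vector W lies both in `m` and in the Lie algebra of `H`. -/
theorem exists_forall_eq_zero_of_exp_mem {H : Subgroup Aˣ} (hH : IsClosed (H : Set Aˣ))
    {m : Submodule ℝ A} (hm : Disjoint m (oneParamSubmodule H hH)) :
    ∃ δ > 0, ∀ Y ∈ m, ‖Y‖ < δ → (∃ u ∈ H, (u : A) = NormedSpace.exp Y) → Y = 0 := by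
  by_contra! hcon
  have hδ : ∀ k : ℕ, (0 : ℝ) < 1 / ((k : ℝ) + 1) := fun k => by positivity
  choose Y hYm hYlt hYH hY0 using fun k : ℕ => hcon _ (hδ k)
  have hpos : ∀ k, 0 < ‖Y k‖ := fun k => norm_pos_iff.2 (hY0 k)
  have hYlim : Filter.Tendsto (fun k => ‖Y k‖) Filter.atTop (𝓝 0) :=
    squeeze_zero (fun k => norm_nonneg _) (fun k => (hYlt k).le)
      tendsto_one_div_add_atTop_nhds_zero_nat
  have _ : ProperSpace A := FiniteDimensional.proper ℝ A
  have hsph : ∀ k, ‖Y k‖⁻¹ • Y k ∈ Metric.sphere (0 : A) 1 := fun k => by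
    simp [norm_smul, (hpos k).ne']
  obtain ⟨W, hW1, φ, hφ, hW⟩ := (isCompact_sphere (0 : A) 1).tendsto_subseq hsph
  have hWm : W ∈ m := by
    refine (Submodule.closed_of_finiteDimensional m).mem_of_tendsto hW
      (Filter.Eventually.of_forall fun k => m.smul_mem _ (hYm _))
  have hWH : W ∈ oneParam H := fun t => by
    refine exists_mem_eq_exp_of_tendsto hH
      (X := fun k => ((⌊t / ‖Y (φ k)‖⌋ : ℝ) * ‖Y (φ k)‖) • (‖Y (φ k)‖⁻¹ • Y (φ k))) (fun k => ?_) ?_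
    · have h1 : (1 : ℝ) ∈ expTimes H (Y (φ k)) := by
        obtain ⟨u, hu, h⟩ := hYH (φ k)
        exact ⟨u, hu, by rw [h, one_smul]⟩
      obtain ⟨u, hu, h⟩ := (expTimes H (Y (φ k))).zsmul_mem h1 ⌊t / ‖Y (φ k)‖⌋
      refine ⟨u, hu, ?_⟩
      rw [h, smul_smul, mul_assoc, mul_inv_cancel₀ (hpos _).ne']
      simp
    · refine Filter.Tendsto.smul ?_ hW
      have h0 := hYlim.comp hφ.tendsto_atTop
      refine tendsto_of_tendsto_of_tendsto_of_le_of_le (g := fun k => t - ‖Y (φ k)‖)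
        (by simpa using h0.const_sub t) tendsto_const_nhds (fun k => ?_) (fun k => ?_)
      · have h := Int.lt_floor_add_one (t / ‖Y (φ k)‖)
        rw [div_lt_iff₀ (hpos _)] at h
        simp only
        linarith
      · have h := Int.floor_le (t / ‖Y (φ k)‖)
        rwa [le_div_iff₀ (hpos _)] at h
  have : W = 0 := Submodule.disjoint_def.1 hm W hWm hWH
  simp [this] at hW1

/-- **Cartan's closed subgroup theorem**: the elements of a closed subgroup that are close to `1`
are exponentials of small elements of its Lie algebra. -/
theorem eventually_exists_eq_exp {H : Subgroup Aˣ} (hH : IsClosed (H : Set Aˣ)) {r : ℝ}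
    (hr : 0 < r) :
    ∀ᶠ a in 𝓝 (1 : A), ∀ u ∈ H, (u : A) = a → ∃ X ∈ oneParam H, ‖X‖ < r ∧
      NormedSpace.exp X = a := by
  let _ : NormedAlgebra ℚ A := NormedAlgebra.restrictScalars ℚ ℝ A
  obtain ⟨m, hm⟩ := (oneParamSubmodule H hH).exists_isCompl
  obtain ⟨δ, hδ, hδm⟩ := exists_forall_eq_zero_of_exp_mem hH hm.symm.disjoint
  let p : A →L[ℝ] A := LinearMap.toContinuousLinearMap
    ((oneParamSubmodule H hH).subtype ∘ₗ (oneParamSubmodule H hH).projectionOnto m hm)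
  have hp : ∀ W, p W ∈ oneParamSubmodule H hH := fun W => Subtype.property _
  have hq : ∀ W, W - p W ∈ m := fun W => by
    have h := Submodule.ker_projectionOnto hm
    rw [← h, LinearMap.mem_ker, map_sub, sub_eq_zero]
    exact (Submodule.projectionOnto_apply_left hm _).symm
  have hexp : HasStrictFDerivAt (NormedSpace.exp : A → A) (1 : A →L[ℝ] A) 0 :=
    hasStrictFDerivAt_exp_zero (𝕂 := ℝ) (𝔸 := A)
  -- This map has derivative the identity at 0, so every element near 1 is a product exp(p W) exp(W
  -- − p W) with W small. If the product lies in `H`, so does the second factor, whose exponent lies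
  -- in the complement `m` and must vanish.
  have hΦ : HasStrictFDerivAt (fun W : A => NormedSpace.exp (p W) * NormedSpace.exp (W - p W))
      ((ContinuousLinearEquiv.refl ℝ A : A ≃L[ℝ] A) : A →L[ℝ] A) 0 := by
    have h1 : HasStrictFDerivAt (fun W : A => NormedSpace.exp (p W)) p 0 := by
      have := HasStrictFDerivAt.comp (0 : A) (g := (NormedSpace.exp : A → A)) (g' := 1) (f := p)
        (by rw [map_zero]; exact hexp) p.hasStrictFDerivAt
      exact this
    have h2 : HasStrictFDerivAt (fun W : A => NormedSpace.exp (W - p W))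
        (ContinuousLinearMap.id ℝ A - p) 0 := by
      have := HasStrictFDerivAt.comp (0 : A) (g := (NormedSpace.exp : A → A)) (g' := 1)
        (f := (ContinuousLinearMap.id ℝ A - p : A →L[ℝ] A))
        (by rw [map_zero]; exact hexp) (ContinuousLinearMap.hasStrictFDerivAt _)
      exact this
    refine (h1.mul' h2).congr_fderiv ?_
    ext W
    simp
  have hmap := hΦ.map_nhds_eq_of_equiv
  simp only [map_zero, sub_zero, NormedSpace.exp_zero, mul_one] at hmap
  rw [← hmap, Filter.eventually_map]
  have hs1 : ∀ᶠ W : A in 𝓝 0, ‖p W‖ < r := by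
    have : Filter.Tendsto (fun W => ‖p W‖) (𝓝 0) (𝓝 0) := by
      simpa using (p.continuous.norm).tendsto 0
    exact this.eventually (gt_mem_nhds hr)
  have hs2 : ∀ᶠ W : A in 𝓝 0, ‖W - p W‖ < δ := by
    have : Filter.Tendsto (fun W => ‖W - p W‖) (𝓝 0) (𝓝 0) := by
      simpa using ((continuous_id.sub p.continuous).norm).tendsto 0
    exact this.eventually (gt_mem_nhds hδ)
  filter_upwards [hs1, hs2] with W h1 h2 u hu huW
  obtain ⟨v, hv, hvW⟩ := hp W 1
  rw [one_smul] at hvW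
  have h0 : W - p W = 0 := hδm _ (hq W) h2 ⟨v⁻¹ * u, H.mul_mem (H.inv_mem hv) hu, by
    rw [Units.val_mul, inv_eq_exp_neg hvW, huW, ← mul_assoc, exp_neg_mul_exp, one_mul]⟩
  exact ⟨p W, hp W, h1, by rw [h0, NormedSpace.exp_zero, mul_one]⟩

/-- A connected closed subgroup is contained in every subgroup containing the exponentials of its
Lie algebra. -/
theorem le_of_forall_exp_mem {H K : Subgroup Aˣ} (hH : IsClosed (H : Set Aˣ))
    (hconn : IsConnected (H : Set Aˣ))
    (hK : ∀ X ∈ oneParam H, ∀ u : Aˣ, (u : A) = NormedSpace.exp X → u ∈ K) : H ≤ K := by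
  have _ : ConnectedSpace H := Subtype.connectedSpace hconn
  -- Elements of `H` near 1 are exponentials, so `K ∩ H` is open in `H`; an open subgroup is closed,
  -- and connectedness finishes.
  have hev : ∀ᶠ u : H in 𝓝 1, u ∈ K.subgroupOf H := by
    have h := (eventually_exists_eq_exp hH one_pos)
    have hc : Filter.Tendsto (fun u : H => ((u : Aˣ) : A)) (𝓝 1) (𝓝 1) := by
      have : Continuous (fun u : H => ((u : Aˣ) : A)) :=
        Units.continuous_val.comp continuous_subtype_val
      simpa using this.tendsto 1
    filter_upwards [hc.eventually h] with u hu
    obtain ⟨X, hX, -, hXu⟩ := hu u u.2 rfl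
    exact Subgroup.mem_subgroupOf.2 (hK X hX u hXu.symm)
  have hopen : IsOpen (K.subgroupOf H : Set H) := Subgroup.isOpen_of_mem_nhds _ hev
  have hclopen : IsClopen (K.subgroupOf H : Set H) :=
    ⟨Subgroup.isClosed_of_isOpen _ hopen, hopen⟩
  have huniv := hclopen.eq_univ ⟨1, Subgroup.one_mem _⟩
  intro u hu
  have : (⟨u, hu⟩ : H) ∈ (K.subgroupOf H : Set H) := huniv ▸ trivial
  exact this

end ClosedSubgroup

/-! ### Spectral projections, traces and eigenvalues of complex matrices. -/

section MatrixAlgebra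

open Polynomial

variable {n : ℕ}

theorem mem_roots_charpoly_iff {M : Matrix (Fin n) (Fin n) ℂ} {μ : ℂ} :
    μ ∈ M.charpoly.roots ↔ ∃ v ≠ 0, M.mulVec v = μ • v := by
  rw [mem_roots M.charpoly_monic.ne_zero, IsRoot, Matrix.eval_charpoly,
    ← Matrix.exists_mulVec_eq_zero_iff]
  refine exists_congr fun v => and_congr_right fun _ => ?_
  rw [Matrix.sub_mulVec, sub_eq_zero, eq_comm]
  simp [Matrix.scalar_apply, ← Matrix.smul_one_eq_diagonal, Matrix.smul_mulVec]

theorem aeval_mulVec_of_eigenvector {M : Matrix (Fin n) (Fin n) ℂ} {μ : ℂ} {v : Fin n → ℂ}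
    (h : M.mulVec v = μ • v) (p : ℂ[X]) : (aeval M p).mulVec v = p.eval μ • v := by
  induction p using Polynomial.induction_on' with
  | add p q hp hq => rw [map_add, Matrix.add_mulVec, hp, hq, eval_add, add_smul]
  | monomial k c =>
    have hk : ∀ k : ℕ, (M ^ k).mulVec v = μ ^ k • v := fun k => by
      induction k with
      | zero => simp
      | succ k ih =>
        rw [pow_succ, ← Matrix.mulVec_mulVec, h, Matrix.mulVec_smul, ih, smul_smul, pow_succ']
    rw [aeval_monomial, eval_monomial, ← Matrix.mulVec_mulVec, hk, Matrix.mulVec_smul,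
      Algebra.algebraMap_eq_smul_one, Matrix.smul_mulVec, Matrix.one_mulVec, smul_smul, mul_comm]

/-- The projection onto a generalised eigenspace, as a polynomial in the matrix. -/
theorem exists_spectral_idempotent {M : Matrix (Fin n) (Fin n) ℂ} {μ : ℂ}
    (hμ : μ ∈ M.charpoly.roots) :
    ∃ p : ℂ[X], aeval M p * aeval M p = aeval M p ∧
      (∃ d : ℕ, (M - μ • 1) ^ d * aeval M p = 0) ∧ p.eval μ = 1 := by
  obtain ⟨q, hq, hnd⟩ := exists_eq_pow_rootMultiplicity_mul_and_not_dvd M.charpoly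
    M.charpoly_monic.ne_zero μ
  set d := rootMultiplicity μ M.charpoly with hd
  have hd0 : d ≠ 0 := by
    rw [mem_roots M.charpoly_monic.ne_zero] at hμ
    exact ((rootMultiplicity_pos M.charpoly_monic.ne_zero).2 hμ).ne'
  have hcop : IsCoprime ((X - C μ) ^ d) q := by
    refine IsCoprime.pow_left ?_
    exact (prime_X_sub_C μ).irreducible.coprime_iff_not_dvd.2 hnd
  obtain ⟨a, b, hab⟩ := hcop
  have hc : aeval M ((X - C μ) ^ d * q) = 0 := by
    rw [← hq]; exact Matrix.aeval_self_charpoly M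
  -- With χ = (X − μ)^d q and the Bézout relation a (X − μ)^d + b q = 1, the polynomial b q is 1
  -- modulo (X − μ)^d and 0 modulo q. Its value at μ is 1 because d > 0.
  refine ⟨b * q, ?_, ⟨d, ?_⟩, ?_⟩
  · rw [← map_mul]
    have : b * q * (b * q) = b * q - (b * a) * ((X - C μ) ^ d * q) := by
      have : b * q = 1 - a * (X - C μ) ^ d := by rw [← hab]; ring
      calc b * q * (b * q) = b * q * (1 - a * (X - C μ) ^ d) := by rw [← this]
        _ = _ := by ring
    rw [this, map_sub, map_mul _ (b * a), hc, mul_zero, sub_zero]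
  · have : (M - μ • 1) ^ d = aeval M ((X - C μ) ^ d) := by
      rw [map_pow, map_sub, aeval_X, aeval_C, Algebra.algebraMap_eq_smul_one]
    rw [this, ← map_mul, mul_left_comm, map_mul, hc, mul_zero]
  · have := congrArg (eval μ) hab
    simpa [hd0] using this

/-- For an eigenvalue μ ≠ 0, X is invertible modulo (X − μ)^d, so the spectral projection at μ has
the form a · r(a) and its trace vanishes. An idempotent of trace zero is zero in characteristic
zero, yet this one fixes an eigenvector. So 0 is the only eigenvalue. -/
theorem isNilpotent_of_trace_eq_zero {a : Matrix (Fin n) (Fin n) ℂ}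
    (h : ∀ p : ℂ[X], (a * aeval a p).trace = 0) : IsNilpotent a := by
  have hroots : ∀ μ ∈ a.charpoly.roots, μ = 0 := by
    intro μ hμ
    by_contra hμ0
    obtain ⟨p, hp, ⟨d, hd⟩, hpμ⟩ := exists_spectral_idempotent hμ
    obtain ⟨v, hv0, hv⟩ := mem_roots_charpoly_iff.1 hμ
    have hcop : IsCoprime (X : ℂ[X]) ((X - C μ) ^ d) := by
      refine IsCoprime.pow_right ?_
      simpa using isCoprime_X_sub_C_of_isUnit_sub (R := ℂ) (a := 0) (b := μ) (by simpa using hμ0)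
    obtain ⟨s, t, hst⟩ := hcop
    have hP : aeval a p = a * aeval a (s * p) := by
      have h2 : aeval a (t * ((X - C μ) ^ d * p)) = 0 := by
        rw [map_mul, map_mul (aeval a) ((X - C μ) ^ d), map_pow, map_sub, aeval_X, aeval_C,
          Algebra.algebraMap_eq_smul_one, hd, mul_zero]
      calc aeval a p = aeval a ((s * X + t * (X - C μ) ^ d) * p) := by rw [hst, one_mul]
        _ = aeval a (X * (s * p)) + aeval a (t * ((X - C μ) ^ d * p)) := by
          rw [← map_add]; congr 1; ring
        _ = _ := by rw [h2, add_zero, map_mul, aeval_X]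
    have htr : (aeval a p).trace = 0 := by rw [hP]; exact h _
    have hzero : aeval a p = 0 := by
      have hlin : IsIdempotentElem (Matrix.toLin' (aeval a p)) := by
        rw [IsIdempotentElem, Module.End.mul_eq_comp, ← Matrix.toLin'_mul, hp]
      have := (LinearMap.IsIdempotentElem.trace_eq_zero_iff hlin).1
        (by rw [Matrix.trace_toLin'_eq, htr])
      simpa using this
    have hv' := aeval_mulVec_of_eigenvector hv p
    rw [hzero, hpμ, one_smul, Matrix.zero_mulVec] at hv'
    exact hv0 hv'.symm
  have hsplit := (IsAlgClosed.splits a.charpoly).eq_prod_roots_of_monic a.charpoly_monic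
  have hrep : a.charpoly.roots = Multiset.replicate (Multiset.card a.charpoly.roots) 0 :=
    Multiset.eq_replicate_card.2 hroots
  rw [hrep] at hsplit
  simp only [Multiset.map_replicate, Multiset.prod_replicate, map_zero, sub_zero] at hsplit
  have := Matrix.aeval_self_charpoly a
  rw [hsplit, map_pow, aeval_X] at this
  exact ⟨_, this⟩

/-- The matrix `S` is `M` on the image of `P`, where μ is the only eigenvalue, and the identity on
the kernel. Its determinant is thus μ^k, with k ≥ 1 because `v` lies in the image. -/
theorem norm_eq_one_of_det_eq_one {M P : Matrix (Fin n) (Fin n) ℂ} {μ : ℂ} {d : ℕ}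
    (hMP : Commute M P) (hP : P * P = P) (hd : (M - μ • 1) ^ d * P = 0) {v : Fin n → ℂ}
    (hv0 : v ≠ 0) (hv : M.mulVec v = μ • v) (hPv : P.mulVec v = v)
    (hdet : (M * P + (1 - P)).det = 1) : ‖μ‖ = 1 := by
  set S := M * P + (1 - P) with hS
  have hSP : S * P = M * P := by
    rw [hS, add_mul, sub_mul, mul_assoc, hP, one_mul, sub_self, add_zero]
  have hPS : P * S = P * M := by
    rw [hS, mul_add, mul_sub, hMP.eq, ← mul_assoc, hP, mul_one, sub_self, add_zero]
  have hroots : ∀ ν ∈ S.charpoly.roots, ν = μ ∨ ν = 1 := by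
    intro ν hν
    obtain ⟨w, hw0, hw⟩ := mem_roots_charpoly_iff.1 hν
    have h1 : M.mulVec (P.mulVec w) = ν • P.mulVec w := by
      rw [Matrix.mulVec_mulVec, hMP.eq, ← hPS, ← Matrix.mulVec_mulVec, hw, Matrix.mulVec_smul]
    by_cases hPw : P.mulVec w = 0
    · right
      have h2 : S.mulVec w = w := by
        rw [hS, Matrix.add_mulVec, Matrix.sub_mulVec, ← Matrix.mulVec_mulVec, hPw]
        simp
      rw [h2] at hw
      have : (1 - ν) • w = 0 := by rw [sub_smul, one_smul, ← hw, sub_self]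
      rcases smul_eq_zero.1 this with h | h
      · exact (sub_eq_zero.1 h).symm
      · exact absurd h hw0
    · left
      have h3 := aeval_mulVec_of_eigenvector h1 ((X - C μ) ^ d)
      rw [map_pow, map_sub, aeval_X, aeval_C, Algebra.algebraMap_eq_smul_one,
        Matrix.mulVec_mulVec, hd, Matrix.zero_mulVec] at h3
      rcases smul_eq_zero.1 h3.symm with h | h
      · simp only [eval_pow, eval_sub, eval_X, eval_C] at h
        exact sub_eq_zero.1 (pow_eq_zero_iff (n := d) (by rintro rfl; simp at h) |>.1 h)
      · exact absurd h hPw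
  have hμ : μ ∈ S.charpoly.roots := by
    refine mem_roots_charpoly_iff.2 ⟨v, hv0, ?_⟩
    rw [hS, Matrix.add_mulVec, Matrix.sub_mulVec, ← Matrix.mulVec_mulVec, hPv, hv]
    simp
  have hprod : ∀ s : Multiset ℂ, (∀ ν ∈ s, ν = μ ∨ ν = 1) → ∃ k : ℕ, s.prod = μ ^ k := by
    intro s
    induction s using Multiset.induction with
    | empty => exact fun _ => ⟨0, by simp⟩
    | cons ν s ih =>
      intro h
      obtain ⟨k, hk⟩ := ih fun x hx => h x (Multiset.mem_cons_of_mem hx)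
      rcases h ν (Multiset.mem_cons_self _ _) with rfl | rfl
      · exact ⟨k + 1, by rw [Multiset.prod_cons, hk, pow_succ']⟩
      · exact ⟨k, by rw [Multiset.prod_cons, hk, one_mul]⟩
  obtain ⟨s, hs⟩ := Multiset.exists_cons_of_mem hμ
  obtain ⟨k, hk⟩ := hprod s fun ν hν => hroots ν (hs ▸ Multiset.mem_cons_of_mem hν)
  rw [Matrix.det_eq_prod_roots_charpoly, hs, Multiset.prod_cons, hk, ← pow_succ'] at hdet
  exact Complex.norm_eq_one_of_pow_eq_one hdet (Nat.succ_ne_zero k)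

theorem norm_trace_le_of_norm_roots {M : Matrix (Fin n) (Fin n) ℂ}
    (h : ∀ μ ∈ M.charpoly.roots, ‖μ‖ = 1) : ‖M.trace‖ ≤ n := by
  have hsum : ∀ s : Multiset ℂ, (∀ μ ∈ s, ‖μ‖ = 1) → ‖s.sum‖ ≤ Multiset.card s := by
    intro s
    induction s using Multiset.induction with
    | empty => simp
    | cons ν s ih =>
      intro h
      rw [Multiset.sum_cons, Multiset.card_cons]
      refine (norm_add_le _ _).trans ?_
      rw [h ν (Multiset.mem_cons_self _ _)]
      have := ih fun x hx => h x (Multiset.mem_cons_of_mem hx)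
      push_cast
      linarith
  rw [Matrix.trace_eq_sum_roots_charpoly]
  refine (hsum _ h).trans ?_
  have := M.charpoly.card_roots'
  rw [Matrix.charpoly_natDegree_eq_dim, Fintype.card_fin] at this
  exact_mod_cast this

end MatrixAlgebra

/-! ### The determinant of the exponential of a traceless matrix. -/

section Det

/-- By multiplicativity the derivative of f(exp(tX)) at any s is f(exp(sX)) times its derivative at
0, and the latter only sees the tangent vector X, so it may be computed along 1 + tX. -/
theorem apply_exp_eq_one {A : Type*} [NormedRing A] [NormedAlgebra ℝ A] [CompleteSpace A]
    (f : A → ℂ) (h1 : f 1 = 1) (hmul : ∀ a b, f (a * b) = f a * f b)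
    (hf : DifferentiableAt ℝ f 1) {X : A} (hX : HasDerivAt (fun t : ℝ => f (1 + t • X)) 0 0) :
    f (NormedSpace.exp X) = 1 := by
  have hX' : fderiv ℝ f 1 X = 0 := by
    have hl : HasDerivAt (fun t : ℝ => 1 + t • X) X 0 := by
      simpa only [id, one_smul] using ((hasDerivAt_id (0 : ℝ)).smul_const X).const_add 1
    have hf1 : HasFDerivAt f (fderiv ℝ f 1) (1 + (0 : ℝ) • X) := by
      rw [zero_smul, add_zero]; exact hf.hasFDerivAt
    exact (hf1.comp_hasDerivAt (0 : ℝ) hl).unique hX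
  have hf0 : HasDerivAt (fun t : ℝ => f (NormedSpace.exp (t • X))) 0 0 := by
    have hl := hasDerivAt_exp_smul_const (𝕂 := ℝ) X (0 : ℝ)
    have hf1 : HasFDerivAt f (fderiv ℝ f 1) (NormedSpace.exp ((0 : ℝ) • X)) := by
      rw [zero_smul, NormedSpace.exp_zero]; exact hf.hasFDerivAt
    refine (hf1.comp_hasDerivAt (0 : ℝ) hl).congr_deriv ?_
    rw [zero_smul, NormedSpace.exp_zero, one_mul, hX']
  have hd : ∀ s : ℝ, HasDerivAt (fun t : ℝ => f (NormedSpace.exp (t • X))) 0 s := by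
    intro s
    have h1 : HasDerivAt (fun t : ℝ => f (NormedSpace.exp ((t - s) • X))) 0 s := by
      have := HasDerivAt.comp_sub_const s s (f := fun t : ℝ => f (NormedSpace.exp (t • X)))
        (f' := 0) (by simpa using hf0)
      exact this
    have h2 := h1.const_mul (f (NormedSpace.exp (s • X)))
    rw [mul_zero] at h2
    refine h2.congr_of_eventuallyEq (Filter.Eventually.of_forall fun t => ?_)
    simp only
    rw [← hmul, ← exp_add_smul, add_sub_cancel]
  have := is_const_of_deriv_eq_zero (fun s => (hd s).differentiableAt) (fun s => (hd s).deriv) 1 0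
  simpa [h1] using this

open scoped Matrix.Norms.Operator
open Polynomial

variable {n : ℕ}

theorem det_exp_eq_one {X : Matrix (Fin n) (Fin n) ℂ} (hX : X.trace = 0) :
    (NormedSpace.exp X).det = 1 := by
  refine apply_exp_eq_one (fun M : Matrix (Fin n) (Fin n) ℂ => M.det) Matrix.det_one
    Matrix.det_mul ?_ ?_
  · have h : ∀ i j, DifferentiableAt ℝ (fun M : Matrix (Fin n) (Fin n) ℂ => M i j) 1 := fun i j =>
      (LinearMap.toContinuousLinearMap (Matrix.entryLinearMap ℝ ℂ i j)).differentiableAt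
    simp only [Matrix.det_apply]
    refine DifferentiableAt.fun_sum fun σ _ => ?_
    refine DifferentiableAt.const_smul ?_ _
    induction (Finset.univ : Finset (Fin n)) using Finset.induction_on with
    | empty => simp
    | insert i s hi ih =>
      simp only [Finset.prod_insert hi]
      exact (h (σ i) i).fun_mul ih
  -- Here det(1 + tX) = 1 + t tr X + t² q(t), and the linear term vanishes.
  · set q := (Matrix.det (1 + (Polynomial.X : ℂ[X]) • X.map C)).divX.divX
    have hc : HasDerivAt (fun t : ℂ => 1 + q.eval t * t ^ 2) 0 ((0 : ℝ) : ℂ) := by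
      have := ((q.hasDerivAt 0).fun_mul ((hasDerivAt_id (0 : ℂ)).fun_pow 2)).const_add 1
      refine (this.congr_deriv (by simp)).congr_of_eventuallyEq ?_
      exact Filter.Eventually.of_forall fun t => rfl
    refine hc.comp_ofReal.congr_of_eventuallyEq (Filter.Eventually.of_forall fun t => ?_)
    have := Matrix.det_one_add_smul (t : ℂ) X
    rw [hX, zero_mul, add_zero] at this
    exact this

end Det


/-! ### The adjoint representation, and `G` as a bounded set times its centre. -/

section AdjointAction

variable {A : Type*} [NormedRing A] [NormedAlgebra ℝ A] [CompleteSpace A]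
  {G : Subgroup Aˣ} {hG : IsClosed (G : Set Aˣ)}

/-- The Lie algebra of a closed subgroup, as a normed space. -/
def LieAlg (G : Subgroup Aˣ) (hG : IsClosed (G : Set Aˣ)) : Type _ := oneParamSubmodule G hG

noncomputable instance : NormedAddCommGroup (LieAlg G hG) :=
  inferInstanceAs (NormedAddCommGroup (oneParamSubmodule G hG))

noncomputable instance : NormedSpace ℝ (LieAlg G hG) :=
  inferInstanceAs (NormedSpace ℝ (oneParamSubmodule G hG))

instance [FiniteDimensional ℝ A] : FiniteDimensional ℝ (LieAlg G hG) :=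
  inferInstanceAs (FiniteDimensional ℝ (oneParamSubmodule G hG))

/-- The inclusion of the Lie algebra in the ambient algebra. -/
noncomputable def incl (hG : IsClosed (G : Set Aˣ)) : LieAlg G hG →L[ℝ] A :=
  LinearMap.mkContinuous (oneParamSubmodule G hG).subtype 1 fun x => by
    rw [one_mul]; exact le_refl ‖(x : oneParamSubmodule G hG)‖

theorem incl_mem (x : LieAlg G hG) : incl hG x ∈ oneParam G := Subtype.property x

/-- An element of the Lie algebra, given by its value in the ambient algebra. -/
def LieAlg.mk (hG : IsClosed (G : Set Aˣ)) (X : A) (hX : X ∈ oneParam G) : LieAlg G hG := ⟨X, hX⟩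

@[simp] theorem incl_mk {X : A} (hX : X ∈ oneParam G) : incl hG (LieAlg.mk hG X hX) = X := rfl

@[ext] theorem LieAlg.ext {x y : LieAlg G hG} (h : incl hG x = incl hG y) : x = y := Subtype.ext h

/-- The commutator bracket on the Lie algebra of a closed subgroup. -/
noncomputable def commutator (hG : IsClosed (G : Set Aˣ)) (x y : LieAlg G hG) : LieAlg G hG :=
  LieAlg.mk hG (incl hG x * incl hG y - incl hG y * incl hG x)
    (lie_mem_oneParam G hG (incl_mem x) (incl_mem y))

@[simp] theorem incl_commutator (x y : LieAlg G hG) :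
    incl hG (commutator hG x y) = incl hG x * incl hG y - incl hG y * incl hG x := rfl

theorem continuous_commutator :
    Continuous fun p : LieAlg G hG × LieAlg G hG => commutator hG p.1 p.2 := by
  have h : Continuous fun p : LieAlg G hG × LieAlg G hG =>
      incl hG (commutator hG p.1 p.2) := by
    simp only [incl_commutator]
    fun_prop
  exact Continuous.subtype_mk h _

/-- The automorphisms of the Lie algebra of a closed subgroup. -/
def autGroup (hG : IsClosed (G : Set Aˣ)) :
    Subgroup (LieAlg G hG →L[ℝ] LieAlg G hG)ˣ where
  carrier := {u | ∀ x y, (u : LieAlg G hG →L[ℝ] LieAlg G hG)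
    (commutator hG x y) = commutator hG (u.1 x) (u.1 y)}
  one_mem' := fun x y => rfl
  mul_mem' := fun {u v} hu hv x y => by
    rw [Units.val_mul, mul_apply_eq_comp, hv, hu]
    rfl
  inv_mem' := fun {u} hu x y => by
    have h1 : ∀ z, u.1 ((u⁻¹).1 z) = z := fun z => by
      rw [← mul_apply_eq_comp, Units.mul_inv]; rfl
    have h2 : ∀ z, (u⁻¹).1 (u.1 z) = z := fun z => by
      rw [← mul_apply_eq_comp, Units.inv_mul]; rfl
    have := hu ((u⁻¹).1 x) ((u⁻¹).1 y)
    rw [h1, h1] at this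
    rw [← this, h2]

theorem isClosed_autGroup : IsClosed (autGroup hG :
    Set (LieAlg G hG →L[ℝ] LieAlg G hG)ˣ) := by
  have h : (autGroup hG : Set (LieAlg G hG →L[ℝ] LieAlg G hG)ˣ) =
      ⋂ x, ⋂ y, {u | u.1 (commutator hG x y) = commutator hG (u.1 x) (u.1 y)} := by
    ext u
    simp only [Set.mem_iInter]
    rfl
  rw [h]
  have hc : ∀ z, Continuous fun u : (LieAlg G hG →L[ℝ] LieAlg G hG)ˣ =>
      u.1 z := fun z => Units.continuous_val.clm_apply continuous_const
  refine isClosed_iInter fun x => isClosed_iInter fun y => isClosed_eq (hc _) ?_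
  exact continuous_commutator.comp ((hc x).prodMk (hc y))

theorem commute_of_forall_oneParam [FiniteDimensional ℝ A] (hG : IsClosed (G : Set Aˣ))
    (hconn : IsConnected (G : Set Aˣ)) {a : A} (ha : ∀ X ∈ oneParam G, Commute a X) {u : Aˣ}
    (hu : u ∈ G) : Commute a u := by
  let _ : NormedAlgebra ℚ A := NormedAlgebra.restrictScalars ℚ ℝ A
  let K : Subgroup Aˣ :=
    { carrier := {u | Commute a u}
      mul_mem' := fun {u v} hu hv => by
        have : Commute a ((u : A) * v) := Commute.mul_right hu hv
        simpa using this
      one_mem' := by simp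
      inv_mem' := fun {u} hu => Commute.units_inv_right hu }
  refine le_of_forall_exp_mem (K := K) hG hconn (fun X hX u hu => ?_) hu
  change Commute a u
  rw [hu]
  exact (ha X hX).exp_right

variable [FiniteDimensional ℝ A]

/-- The adjoint representation on the Lie algebra of a closed subgroup. -/
noncomputable def Ad (hG : IsClosed (G : Set Aˣ)) :
    G →* (LieAlg G hG →L[ℝ] LieAlg G hG) where
  toFun u := LinearMap.toContinuousLinearMap
    { toFun := fun x => LieAlg.mk hG ((u : Aˣ) * incl hG x * ((u⁻¹ : G) : Aˣ))
        (conj_mem_oneParam G u.2 (incl_mem x))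
      map_add' := fun x y => by ext; simp [mul_add, add_mul]
      map_smul' := fun c x => by ext; simp }
  map_one' := by
    ext x
    change (((1 : G) : Aˣ) : A) * incl hG x * ((((1 : G)⁻¹ : G) : Aˣ) : A) = incl hG x
    simp
  map_mul' u v := by
    ext x
    change (((u * v : G) : Aˣ) : A) * incl hG x * ((((u * v : G)⁻¹ : G) : Aˣ) : A) =
      ((u : Aˣ) : A) * (((v : Aˣ) : A) * incl hG x * (((v⁻¹ : G) : Aˣ) : A)) *
        (((u⁻¹ : G) : Aˣ) : A)
    simp [mul_assoc]

@[simp] theorem incl_Ad_apply (u : G) (x : LieAlg G hG) :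
    incl hG (Ad hG u x) = (u : Aˣ) * incl hG x * ((u⁻¹ : G) : Aˣ) := rfl

/-- This is exp(ad Y) = Ad(exp Y): the curve exp(−tY) · exp(tD)x · exp(tY) has zero derivative. -/
theorem incl_exp_apply_eq_conj {D : LieAlg G hG →L[ℝ] LieAlg G hG} {Y : A}
    (hD : ∀ x : LieAlg G hG, incl hG (D x) = Y * incl hG x - incl hG x * Y) (x : LieAlg G hG) :
    incl hG (NormedSpace.exp D x) = NormedSpace.exp Y * incl hG x * NormedSpace.exp (-Y) := by
  have hφ : ∀ t : ℝ, HasDerivAt (fun t : ℝ => NormedSpace.exp (t • (-Y)) *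
      incl hG (NormedSpace.exp (t • D) x) * NormedSpace.exp (t • Y)) 0 t := by
    intro t
    have h1 := hasDerivAt_exp_smul_const (𝕂 := ℝ) (-Y) t
    have h3 := hasDerivAt_exp_smul_const' (𝕂 := ℝ) Y t
    have h2 : HasDerivAt (fun t : ℝ => incl hG (NormedSpace.exp (t • D) x))
        (incl hG (D (NormedSpace.exp (t • D) x))) t :=
      (incl hG ∘L
        ContinuousLinearMap.apply ℝ (LieAlg G hG) x).hasFDerivAt.comp_hasDerivAt t
        (hasDerivAt_exp_smul_const' (𝕂 := ℝ) D t)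
    refine ((h1.fun_mul h2).fun_mul h3).congr_deriv ?_
    rw [hD]
    noncomm_ring
  have h := is_const_of_deriv_eq_zero (fun s => (hφ s).differentiableAt)
    (fun s => (hφ s).deriv) 1 0
  simp only [one_smul, zero_smul, NormedSpace.exp_zero, one_mul, mul_one] at h
  have h1 : (1 : LieAlg G hG →L[ℝ] LieAlg G hG) x = x := rfl
  rw [h1] at h
  calc incl hG (NormedSpace.exp D x)
      = (NormedSpace.exp Y * NormedSpace.exp (-Y)) * incl hG (NormedSpace.exp D x) *
        (NormedSpace.exp Y * NormedSpace.exp (-Y)) := by rw [exp_mul_exp_neg, one_mul, mul_one]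
    _ = NormedSpace.exp Y * (NormedSpace.exp (-Y) * incl hG (NormedSpace.exp D x) *
        NormedSpace.exp Y) * NormedSpace.exp (-Y) := by noncomm_ring
    _ = _ := by rw [h]

/-- Differentiating at t = 0 the identity saying that exp(tD) preserves brackets. -/
theorem leibniz_of_mem_oneParam_autGroup
    {D : LieAlg G hG →L[ℝ] LieAlg G hG} (hD : D ∈ oneParam (autGroup hG))
    (x y : LieAlg G hG) :
    D (commutator hG x y) = commutator hG (D x) y + commutator hG x (D y) := by
  have hd : ∀ z, HasDerivAt (fun t : ℝ => incl hG (NormedSpace.exp (t • D) z)) (incl hG (D z)) 0 := by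
    intro z
    have := (incl hG ∘L
        ContinuousLinearMap.apply ℝ (LieAlg G hG) z).hasFDerivAt.comp_hasDerivAt (0 : ℝ)
        (hasDerivAt_exp_smul_const (𝕂 := ℝ) D (0 : ℝ))
    refine this.congr_deriv ?_
    simp
  have h0 : ∀ z : LieAlg G hG,
      NormedSpace.exp ((0 : ℝ) • D) z = z := fun z => by
    rw [zero_smul, NormedSpace.exp_zero]; rfl
  have h1 := ((hd x).fun_mul (hd y)).fun_sub ((hd y).fun_mul (hd x))
  have h2 := (hd (commutator hG x y)).congr_of_eventuallyEq (f₁ := fun t : ℝ =>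
    incl hG (NormedSpace.exp (t • D) x) * incl hG (NormedSpace.exp (t • D) y) -
    incl hG (NormedSpace.exp (t • D) y) * incl hG (NormedSpace.exp (t • D) x))
    (Filter.Eventually.of_forall fun t => by
      obtain ⟨u, hu, hut⟩ := hD t
      have := congrArg (incl hG) (hu x y)
      rw [hut] at this
      exact this.symm)
  ext
  rw [h2.unique h1]
  simp only [h0, map_add, incl_commutator]
  abel

/-- If all derivations of the Lie algebra are inner, then the elements of `G` whose adjoint action
is close to the identity act as exponentials of bounded elements of the Lie algebra. -/
theorem exists_conj_eq_exp_conj_of_norm_Ad_sub_one_lt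
    (hder : ∀ D : LieAlg G hG →ₗ[ℝ] LieAlg G hG,
      (∀ x y, D (commutator hG x y) = commutator hG (D x) y + commutator hG x (D y)) →
      ∃ Y, ∀ x, D x = commutator hG Y x)
    (hcenter : ∀ Y, (∀ x, commutator hG Y x = 0) → Y = 0) :
    ∃ K ε : ℝ, 0 < ε ∧ ∀ u : G, ‖Ad hG u - 1‖ < ε → ∃ Y ∈ oneParam G, ‖Y‖ ≤ K ∧
      ∀ x ∈ oneParam G, ((u : Aˣ) : A) * x * (((u⁻¹ : G) : Aˣ) : A) =
        NormedSpace.exp Y * x * NormedSpace.exp (-Y) := by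
  -- Cartan's theorem in the closed group of automorphisms: an automorphism near 1 is exp D with D a
  -- derivation and ‖D‖ < 1.
  have hev := eventually_exists_eq_exp (isClosed_autGroup (hG := hG)) one_pos
  obtain ⟨ε, hε, hball⟩ := Metric.eventually_nhds_iff.1 hev
  let adL : LieAlg G hG →ₗ[ℝ] (LieAlg G hG →L[ℝ] LieAlg G hG) :=
    { toFun := fun Y => LinearMap.toContinuousLinearMap
        { toFun := fun x => commutator hG Y x
          map_add' := fun x y => by ext; simp [mul_add, add_mul]; abel
          map_smul' := fun c x => by ext; simp [smul_sub] }
      map_add' := fun x y => by ext; simp [mul_add, add_mul]; abel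
      map_smul' := fun c x => by ext; simp [smul_sub] }
  have hadL : ∀ Y x, adL Y x = commutator hG Y x := fun Y x => rfl
  have hker : LinearMap.ker adL = ⊥ := by
    rw [LinearMap.ker_eq_bot']
    intro Y hY
    exact hcenter Y fun x => by rw [← hadL, hY]; rfl
  -- Injectivity of ad in finite dimension turns the bound on D = ad Y into the bound `K` on Y.
  obtain ⟨K, -, hK⟩ := adL.exists_antilipschitzWith hker
  refine ⟨K, ε, hε, fun u hu => ?_⟩
  have hmem : (Ad hG).toHomUnits u ∈ autGroup hG := fun x y => by
    ext
    change incl hG (Ad hG u (commutator hG x y)) = incl hG (commutator hG (Ad hG u x) (Ad hG u y))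
    have h1 : (((u⁻¹ : G) : Aˣ) : A) * ((u : Aˣ) : A) = 1 := by simp
    simp only [incl_Ad_apply, incl_commutator]
    generalize ((u : Aˣ) : A) = a at *
    generalize (((u⁻¹ : G) : Aˣ) : A) = b at *
    calc a * (incl hG x * incl hG y - incl hG y * incl hG x) * b
        = a * incl hG x * 1 * incl hG y * b - a * incl hG y * 1 * incl hG x * b := by noncomm_ring
      _ = _ := by rw [← h1]; noncomm_ring
  obtain ⟨D, hD, hD1, hDu⟩ := hball (y := Ad hG u) (by rwa [dist_eq_norm]) _ hmem rfl
  obtain ⟨Y, hY⟩ := hder D (leibniz_of_mem_oneParam_autGroup hD)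
  have hDY : D = adL Y := by ext1 x; exact hY x
  refine ⟨incl hG Y, incl_mem Y, ?_, fun x hx => ?_⟩
  · have := hK.le_mul_norm (map_zero _) Y
    rw [← hDY] at this
    refine this.trans ?_
    exact mul_le_of_le_one_right K.2 hD1.le
  · have := incl_exp_apply_eq_conj (hG := hG) (D := D) (Y := incl hG Y)
      (fun x => by rw [hDY]; rfl) (LieAlg.mk hG x hx)
    rwa [hDu] at this

/-- A connected closed subgroup with bounded adjoint action and without outer derivations is the
product of a bounded set and of its centre. -/
theorem exists_bound_mul_center (hconn : IsConnected (G : Set Aˣ))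
    (hder : ∀ D : LieAlg G hG →ₗ[ℝ] LieAlg G hG,
      (∀ x y, D (commutator hG x y) = commutator hG (D x) y + commutator hG x (D y)) →
      ∃ Y, ∀ x, D x = commutator hG Y x)
    (hcenter : ∀ Y, (∀ x, commutator hG Y x = 0) → Y = 0)
    {C : ℝ} (hAd : ∀ u : G, ‖Ad hG u‖ ≤ C) :
    ∃ K : ℝ, ∀ u ∈ G, ∃ v ∈ G, ∃ z ∈ G, u = v * z ∧ ‖(v : A)‖ ≤ K ∧
      ∀ w ∈ G, Commute (z : A) w := by
  let _ : NormedAlgebra ℚ A := NormedAlgebra.restrictScalars ℚ ℝ A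
  obtain ⟨K, ε, hε, hK⟩ := exists_conj_eq_exp_conj_of_norm_Ad_sub_one_lt hder hcenter
  have hC : 0 ≤ C := (norm_nonneg _).trans (hAd 1)
  have _ : ProperSpace A := FiniteDimensional.proper ℝ A
  have _ : ProperSpace (LieAlg G hG →L[ℝ] LieAlg G hG) :=
    FiniteDimensional.proper ℝ _
  have htb : TotallyBounded (Set.range (Ad hG)) := by
    refine TotallyBounded.subset ?_ (isCompact_closedBall
      (0 : LieAlg G hG →L[ℝ] LieAlg G hG) C).totallyBounded
    rintro _ ⟨u, rfl⟩
    simpa using hAd u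
  -- Multiplying by `Ad (w f)⁻¹`, of norm at most `C`, turns a distance below ε / (C + 1) into one
  -- below ε; the added 1 keeps the denominator positive.
  obtain ⟨t, ht, htfin, hcover⟩ := Metric.finite_approx_of_totallyBounded htb (ε / (C + 1))
    (by positivity)
  choose! w hw using fun f (hf : f ∈ t) => ht hf
  obtain ⟨Kw, hKw⟩ := (htfin.image fun f => ‖(((w f : G) : Aˣ) : A)‖).bddAbove
  obtain ⟨Ke, hKe⟩ := ((isCompact_closedBall (0 : A) K).image
    (NormedSpace.exp_continuous (𝔸 := A))).isBounded.exists_norm_le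
  refine ⟨Kw * Ke, fun u hu => ?_⟩
  obtain ⟨f, hf, hfu⟩ := Set.mem_iUnion₂.1 (hcover (Set.mem_range_self (⟨u, hu⟩ : G)))
  have hlt : ‖Ad hG ((w f)⁻¹ * ⟨u, hu⟩) - 1‖ < ε := by
    have h1 : Ad hG ((w f)⁻¹ * ⟨u, hu⟩) - 1 = Ad hG (w f)⁻¹ * (Ad hG ⟨u, hu⟩ - f) := by
      rw [mul_sub, ← map_mul]
      congr 1
      nth_rewrite 2 [← hw f hf]
      rw [← map_mul, inv_mul_cancel, map_one]
    rw [h1]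
    rw [mem_ball_iff_norm, lt_div_iff₀ (by positivity)] at hfu
    calc _ ≤ ‖Ad hG (w f)⁻¹‖ * ‖Ad hG ⟨u, hu⟩ - f‖ := norm_mul_le _ _
      _ ≤ (C + 1) * ‖Ad hG ⟨u, hu⟩ - f‖ := by
        gcongr
        linarith [hAd (w f)⁻¹]
      _ < ε := by rwa [mul_comm]
  obtain ⟨Y, hYG, hYK, hY⟩ := hK _ hlt
  obtain ⟨e, heG, he⟩ := hYG 1
  rw [one_smul] at he
  -- `(w f)⁻¹ * u` and `e = exp Y` have the same adjoint action, so `(w f * e)⁻¹ * u` commutes with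
  -- the Lie algebra, and by connectedness with `G`.
  refine ⟨w f * e, G.mul_mem (w f).2 heG, (w f * e)⁻¹ * u,
    G.mul_mem (G.inv_mem (G.mul_mem (w f).2 heG)) hu, by group, ?_, fun v hv => ?_⟩
  · have h1 : ‖(((w f : G) : Aˣ) : A)‖ ≤ Kw := hKw ⟨f, hf, rfl⟩
    have h2 : ‖(e : A)‖ ≤ Ke := by
      rw [he]
      exact hKe _ ⟨Y, by simpa using hYK, rfl⟩
    rw [Units.val_mul]
    exact (norm_mul_le _ _).trans (mul_le_mul h1 h2 (norm_nonneg _) ((norm_nonneg _).trans h1))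
  · refine commute_of_forall_oneParam hG hconn (fun x hx => ?_) hv
    have h := hY x hx
    rw [← inv_eq_exp_neg he, ← he] at h
    set s : Aˣ := (w f : Aˣ)⁻¹ * u with hs
    have h' : (s : A) * x * ((s⁻¹ : Aˣ) : A) = e * x * ((e⁻¹ : Aˣ) : A) := h
    have hz : ((w f : Aˣ) * e)⁻¹ * u = e⁻¹ * s := by rw [hs]; group
    rw [hz, Commute, SemiconjBy, Units.val_mul]
    have h3 : (s : A) * x = e * x * ((e⁻¹ : Aˣ) : A) * s := by
      rw [← h']; simp
    calc ((e⁻¹ : Aˣ) : A) * s * x = ((e⁻¹ : Aˣ) : A) * (s * x) := mul_assoc _ _ _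
      _ = _ := by rw [h3]; simp [mul_assoc]

end AdjointAction

/-! ### Exponentials, idempotents and commutation in a Banach algebra. -/

section BanachAlgebra

variable {A : Type*} [NormedRing A] [NormedAlgebra ℝ A] [CompleteSpace A]

theorem exp_mul_eq_self {Y P : A} (h : Y * P = 0) : NormedSpace.exp Y * P = P := by
  have hd : ∀ t : ℝ, HasDerivAt (fun t : ℝ => NormedSpace.exp (t • Y) * P) 0 t := fun t => by
    refine ((hasDerivAt_exp_smul_const (𝕂 := ℝ) Y t).mul_const P).congr_deriv ?_
    rw [mul_assoc, h, mul_zero]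
  have := is_const_of_deriv_eq_zero (fun s => (hd s).differentiableAt) (fun s => (hd s).deriv) 1 0
  simpa using this

/-- Split X into the commuting pieces X P and X (1 − P), each of whose exponentials is trivial on
the other's summand. -/
theorem exp_mul_idempotent {X P : A} (hP : P * P = P) (hc : Commute X P) :
    NormedSpace.exp (X * P) = NormedSpace.exp X * P + (1 - P) := by
  let _ : NormedAlgebra ℚ A := NormedAlgebra.restrictScalars ℚ ℝ A
  have h0 : P * (1 - P) = 0 := by rw [mul_sub, hP, mul_one, sub_self]
  have h0' : (1 - P) * P = 0 := by rw [sub_mul, hP, one_mul, sub_self]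
  have hcomm : Commute (X * P) (X * (1 - P)) := by
    have h1 : Commute P (1 - P) := (Commute.one_right P).sub_right (Commute.refl P)
    have h2 : Commute X (1 - P) := (Commute.one_right X).sub_right hc
    exact ((Commute.refl X).mul_right h2).mul_left (hc.symm.mul_right h1)
  have h1 : NormedSpace.exp X = NormedSpace.exp (X * P) * NormedSpace.exp (X * (1 - P)) := by
    rw [← NormedSpace.exp_add_of_commute hcomm, ← mul_add, add_sub_cancel, mul_one]
  have h2 : NormedSpace.exp (X * (1 - P)) * P = P := exp_mul_eq_self (by rw [mul_assoc, h0', mul_zero])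
  have h3 : NormedSpace.exp (X * P) * (1 - P) = 1 - P :=
    exp_mul_eq_self (by rw [mul_assoc, h0, mul_zero])
  rw [h1, mul_assoc, h2]
  calc NormedSpace.exp (X * P) = NormedSpace.exp (X * P) * P + NormedSpace.exp (X * P) * (1 - P) := by
        rw [← mul_add, add_sub_cancel, mul_one]
    _ = _ := by rw [h3]

theorem commute_of_forall_commute_exp {a X : A}
    (h : ∀ t : ℝ, Commute a (NormedSpace.exp (t • X))) : Commute a X := by
  have h0 := hasDerivAt_exp_smul_const (𝕂 := ℝ) X (0 : ℝ)
  have h1 := (h0.const_mul a)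
  have h2 := (h0.mul_const a).congr_of_eventuallyEq
    (f₁ := fun t : ℝ => a * NormedSpace.exp (t • X))
    (Filter.Eventually.of_forall fun t => (h t).eq)
  have := h1.unique h2
  simpa [Commute, SemiconjBy] using this

end BanachAlgebra

/-- A closed subgroup of the units of a finite-dimensional algebra is compact if it is bounded. -/
theorem isCompact_of_forall_norm_le {A : Type*} [NormedRing A] [NormedAlgebra ℝ A]
    [FiniteDimensional ℝ A] {G : Subgroup Aˣ}
    (hG : IsClosed (G : Set Aˣ)) {K : ℝ} (hK : ∀ u ∈ G, ‖(u : A)‖ ≤ K) :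
    IsCompact (G : Set Aˣ) := by
  have _ : ProperSpace A := FiniteDimensional.proper ℝ A
  have hB := isCompact_closedBall (0 : A) K
  have hBop : IsCompact (MulOpposite.unop ⁻¹' Metric.closedBall (0 : A) K) :=
    MulOpposite.opHomeomorph.symm.isClosedEmbedding.isCompact_preimage hB
  -- The topology of the units records u and u⁻¹ together; the inverses obey the same bound because
  -- `G` is a group.
  refine (Units.isClosedEmbedding_embedProduct.isCompact_preimage (hB.prod hBop)).of_isClosed_subset
    hG fun u hu => ?_
  have hu' := hK _ (G.inv_mem hu)
  exact ⟨by simpa using hK u hu, by simpa using hu'⟩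

/-! ### The centre of a connected simple linear group is bounded. -/

section Center

open scoped Matrix.Norms.Operator
open Polynomial

variable {n : ℕ} {G : Subgroup (GL (Fin n) ℂ)} {hG : IsClosed (G : Set (GL (Fin n) ℂ))}

/-- The Lie algebra is spanned by brackets, and tr([a, b]P) = 0 by cyclicity when P commutes with a.
-/
theorem trace_mul_eq_zero_of_commute (hsimple : LieAlgebra.IsSimple ℝ (lieAlgebra G hG))
    {P : Matrix (Fin n) (Fin n) ℂ} (hP : ∀ X ∈ oneParam G, Commute P X)
    {X : Matrix (Fin n) (Fin n) ℂ} (hX : X ∈ oneParam G) : (X * P).trace = 0 := by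
  have h : (⟨X, hX⟩ : lieAlgebra G hG) ∈
      ⁅(⊤ : LieIdeal ℝ (lieAlgebra G hG)), (⊤ : LieIdeal ℝ (lieAlgebra G hG))⁆ := by
    rw [LieAlgebra.IsSimple.lie_top_top]; trivial
  rw [← LieSubmodule.mem_toSubmodule, LieSubmodule.lieIdeal_oper_eq_linear_span] at h
  change (((⟨X, hX⟩ : lieAlgebra G hG) : Matrix (Fin n) (Fin n) ℂ) * P).trace = 0
  generalize (⟨X, hX⟩ : lieAlgebra G hG) = x at h
  induction h using Submodule.span_induction with
  | mem y hy =>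
    obtain ⟨⟨a, -⟩, ⟨b, -⟩, rfl⟩ := hy
    change (((a : Matrix (Fin n) (Fin n) ℂ) * b - b * a) * P).trace = 0
    rw [sub_mul, Matrix.trace_sub, mul_assoc (b : Matrix (Fin n) (Fin n) ℂ),
      ← (hP a a.2).eq, Matrix.trace_mul_comm (b : Matrix (Fin n) (Fin n) ℂ),
      mul_assoc P, Matrix.trace_mul_comm P, sub_self]
  | zero => simp
  | add y z _ _ hy hz => simp [add_mul, hy, hz]
  | smul c y _ hy => simp [hy]

/-- On the centralizer of `P` the map u ↦ det(uP + 1 − P) is multiplicative. It is 1 on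
exponentials, since exp(X)P + 1 − P = exp(XP) with tr(XP) = 0, and these generate the connected
group `G`. -/
theorem det_mul_idempotent_eq_one (hconn : IsConnected (G : Set (GL (Fin n) ℂ)))
    (hsimple : LieAlgebra.IsSimple ℝ (lieAlgebra G hG))
    {P : Matrix (Fin n) (Fin n) ℂ} (hPP : P * P = P) (hP : ∀ X ∈ oneParam G, Commute P X)
    {u : GL (Fin n) ℂ} (hu : u ∈ G) :
    ((u : Matrix (Fin n) (Fin n) ℂ) * P + (1 - P)).det = 1 := by
  have hmul : ∀ a b : Matrix (Fin n) (Fin n) ℂ, Commute P b →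
      (a * P + (1 - P)) * (b * P + (1 - P)) = a * b * P + (1 - P) := by
    intro a b hb
    have h1 : P * (b * P) = b * P := by rw [← mul_assoc, hb.eq, mul_assoc, hPP]
    calc (a * P + (1 - P)) * (b * P + (1 - P))
        = a * (P * (b * P)) + (b * P - P * (b * P)) + a * (P - P * P) + (1 - P - (P - P * P)) := by
          noncomm_ring
      _ = _ := by rw [h1, hPP]; noncomm_ring
  have hcomm : ∀ u ∈ G, Commute P (u : Matrix (Fin n) (Fin n) ℂ) := fun u hu =>
    commute_of_forall_oneParam hG hconn hP hu
  let K : Subgroup (GL (Fin n) ℂ) :=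
    { carrier := {u | Commute P (u : Matrix (Fin n) (Fin n) ℂ) ∧
        ((u : Matrix (Fin n) (Fin n) ℂ) * P + (1 - P)).det = 1}
      mul_mem' := fun {u v} hu hv => by
        refine ⟨by rw [Units.val_mul]; exact hu.1.mul_right hv.1, ?_⟩
        rw [Units.val_mul, ← hmul _ _ hv.1, Matrix.det_mul, hu.2, hv.2, one_mul]
      one_mem' := by simp
      inv_mem' := fun {u} hu => by
        refine ⟨hu.1.units_inv_right, ?_⟩
        have := hmul (↑(u⁻¹) : Matrix (Fin n) (Fin n) ℂ) u hu.1
        have h2 := congrArg Matrix.det this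
        rw [Matrix.det_mul, hu.2, mul_one, Units.inv_mul, one_mul, add_sub_cancel,
          Matrix.det_one] at h2
        exact h2 }
  refine (le_of_forall_exp_mem (K := K) hG hconn (fun X hX u hu => ?_) hu).2
  have hPX := hP X hX
  refine ⟨by rw [hu]; exact hPX.exp_right, ?_⟩
  rw [hu, ← exp_mul_idempotent hPP hPX.symm]
  exact det_exp_eq_one (trace_mul_eq_zero_of_commute hsimple hP hX)

theorem commute_oneParam_of_commute {a : Matrix (Fin n) (Fin n) ℂ}
    (ha : ∀ u ∈ G, Commute a (u : Matrix (Fin n) (Fin n) ℂ))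
    {X : Matrix (Fin n) (Fin n) ℂ} (hX : X ∈ oneParam G) : Commute a X :=
  commute_of_forall_commute_exp fun t => by
    obtain ⟨u, hu, hut⟩ := hX t
    exact (congrArg (Commute a) hut).mp (ha u hu)

/-- The spectral projection of `z` at μ is a polynomial in `z`, so it commutes with the Lie algebra
and the determinant on its image is 1. -/
theorem norm_eq_one_of_mem_roots_charpoly (hconn : IsConnected (G : Set (GL (Fin n) ℂ)))
    (hsimple : LieAlgebra.IsSimple ℝ (lieAlgebra G hG)) {z : GL (Fin n) ℂ} (hz : z ∈ G)
    (hzc : ∀ u ∈ G, Commute (z : Matrix (Fin n) (Fin n) ℂ) (u : Matrix (Fin n) (Fin n) ℂ))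
    {μ : ℂ} (hμ : μ ∈ (z : Matrix (Fin n) (Fin n) ℂ).charpoly.roots) : ‖μ‖ = 1 := by
  obtain ⟨p, hpp, ⟨d, hd⟩, hpμ⟩ := exists_spectral_idempotent hμ
  obtain ⟨v, hv0, hv⟩ := mem_roots_charpoly_iff.1 hμ
  have hcomm : ∀ a, Commute (z : Matrix (Fin n) (Fin n) ℂ) a →
      Commute (aeval (z : Matrix (Fin n) (Fin n) ℂ) p) a := by
    intro a ha
    have hz : (z : Matrix (Fin n) (Fin n) ℂ) ∈ Subalgebra.centralizer ℂ {a} := by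
      simpa [Subalgebra.mem_centralizer_iff] using ha.eq.symm
    have h := (aeval (⟨z, hz⟩ : Subalgebra.centralizer ℂ {a}) p).2
    rw [← Subalgebra.coe_val, ← Polynomial.aeval_algHom_apply] at h
    exact (h a rfl).symm
  refine norm_eq_one_of_det_eq_one (hcomm _ (Commute.refl _)).symm hpp hd hv0 hv ?_ ?_
  · rw [aeval_mulVec_of_eigenvector hv, hpμ, one_smul]
  · exact det_mul_idempotent_eq_one hconn hsimple hpp
      (fun X hX => hcomm X (commute_oneParam_of_commute hzc hX)) hz

/-- The functional b ↦ tr(ab) vanishes on the centralizer by `h` and on [𝔤, M_n(ℂ)] because `a`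
commutes with 𝔤. These two span all matrices, so it vanishes at the conjugate transpose of `a`. -/
theorem eq_zero_of_trace_mul_centralizer_eq_zero
    (hsimple : LieAlgebra.IsSimple ℝ (lieAlgebra G hG)) {a : Matrix (Fin n) (Fin n) ℂ}
    (ha : ∀ X ∈ oneParam G, Commute a X)
    (h : ∀ b : Matrix (Fin n) (Fin n) ℂ, (∀ X ∈ oneParam G, Commute b X) → (a * b).trace = 0) :
    a = 0 := by
  let f : Matrix (Fin n) (Fin n) ℂ →ₗ[ℝ] ℂ :=
    { toFun := fun b => (a * b).trace
      map_add' := fun b c => by simp [mul_add]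
      map_smul' := fun c b => by simp }
  have hle : (LieModule.maxTrivSubmodule ℝ (lieAlgebra G hG) (Matrix (Fin n) (Fin n) ℂ) ⊔
      ⁅(⊤ : LieIdeal ℝ (lieAlgebra G hG)),
        (⊤ : LieSubmodule ℝ (lieAlgebra G hG) (Matrix (Fin n) (Fin n) ℂ))⁆).toSubmodule ≤
      LinearMap.ker f := by
    rw [LieSubmodule.sup_toSubmodule, LieSubmodule.lieIdeal_oper_eq_linear_span]
    refine sup_le (fun b hb => ?_) (Submodule.span_le.2 ?_)
    · refine h b fun X hX => ?_
      have : X * b - b * X = 0 := hb ⟨X, hX⟩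
      exact (sub_eq_zero.1 this).symm
    · rintro _ ⟨⟨⟨X, hX⟩, -⟩, ⟨b, -⟩, rfl⟩
      change (a * (X * b - b * X)).trace = 0
      rw [mul_sub, Matrix.trace_sub, ← mul_assoc, (ha X hX).eq, ← mul_assoc a,
        Matrix.trace_mul_comm (a * b), mul_assoc, sub_self]
  rw [LieModule.maxTrivSubmodule_sup_lie_top] at hle
  have : (a * a.conjTranspose).trace = 0 := hle (x := a.conjTranspose) trivial
  open scoped ComplexOrder in
  exact Matrix.trace_mul_conjTranspose_self_eq_zero_iff.1 this

/-- The matrices in the centre of a linear group. -/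
def centerMatrices (G : Subgroup (GL (Fin n) ℂ)) : Submonoid (Matrix (Fin n) (Fin n) ℂ) where
  carrier := {a | ∃ z ∈ G, (z : Matrix (Fin n) (Fin n) ℂ) = a ∧
    ∀ u ∈ G, Commute a (u : Matrix (Fin n) (Fin n) ℂ)}
  one_mem' := ⟨1, G.one_mem, by simp⟩
  mul_mem' := by
    rintro _ _ ⟨z, hz, rfl, hzc⟩ ⟨w, hw, rfl, hwc⟩
    exact ⟨z * w, G.mul_mem hz hw, by simp, fun u hu => (hzc u hu).mul_left (hwc u hu)⟩

theorem norm_trace_centerMatrices_le (hconn : IsConnected (G : Set (GL (Fin n) ℂ)))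
    (hsimple : LieAlgebra.IsSimple ℝ (lieAlgebra G hG)) {a : Matrix (Fin n) (Fin n) ℂ}
    (ha : a ∈ centerMatrices G) : ‖a.trace‖ ≤ n := by
  obtain ⟨z, hz, rfl, hzc⟩ := ha
  exact norm_trace_le_of_norm_roots fun μ hμ =>
    norm_eq_one_of_mem_roots_charpoly hconn hsimple hz hzc hμ

/-- The span of the centre is an algebra, so every a · p(a) lies in it, and traces against the
centre force `a` to be nilpotent. A matrix b centralizing the Lie algebra commutes with `a`; hence
ab is nilpotent and has trace zero. -/
theorem eq_zero_of_mem_span_centerMatrices (hconn : IsConnected (G : Set (GL (Fin n) ℂ)))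
    (hsimple : LieAlgebra.IsSimple ℝ (lieAlgebra G hG)) {a : Matrix (Fin n) (Fin n) ℂ}
    (ha : a ∈ Submodule.span ℂ (centerMatrices G : Set (Matrix (Fin n) (Fin n) ℂ)))
    (h : ∀ z ∈ centerMatrices G, (a * z).trace = 0) : a = 0 := by
  set R := Algebra.adjoin ℂ (centerMatrices G : Set (Matrix (Fin n) (Fin n) ℂ)) with hR
  have hRspan : ∀ b, b ∈ R ↔
      b ∈ Submodule.span ℂ (centerMatrices G : Set (Matrix (Fin n) (Fin n) ℂ)) := fun b => by
    rw [← Subalgebra.mem_toSubmodule, hR, Algebra.adjoin_eq_span, Submonoid.closure_eq]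
  have hcomm : ∀ b, (∀ X ∈ oneParam G, Commute b X) → Commute a b := by
    clear h
    intro b hb
    induction ha using Submodule.span_induction with
    | mem y hy =>
      obtain ⟨z, hz, rfl, -⟩ := hy
      exact (commute_of_forall_oneParam hG hconn hb hz).symm
    | zero => exact Commute.zero_left b
    | add y z _ _ hy hz => exact hy.add_left hz
    | smul c y _ hy => exact hy.smul_left c
  have haX : ∀ X ∈ oneParam G, Commute a X := by
    clear hcomm h
    intro X hX
    induction ha using Submodule.span_induction with
    | mem y hy =>
      obtain ⟨z, hz, rfl, hzc⟩ := hy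
      exact commute_oneParam_of_commute hzc hX
    | zero => exact Commute.zero_left X
    | add y z _ _ hy hz => exact hy.add_left hz
    | smul c y _ hy => exact hy.smul_left c
  have htr : ∀ b ∈ R, (a * b).trace = 0 := by
    intro b hb
    rw [hRspan] at hb
    induction hb using Submodule.span_induction with
    | mem y hy => exact h y hy
    | zero => simp
    | add y z _ _ hy hz => rw [mul_add, Matrix.trace_add, hy, hz, add_zero]
    | smul c y _ hy => rw [mul_smul_comm, Matrix.trace_smul, hy, smul_zero]
  have hnil : IsNilpotent a := isNilpotent_of_trace_eq_zero fun p => by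
    refine htr _ ?_
    have := (aeval (⟨a, (hRspan a).2 ha⟩ : R) p).2
    rwa [← Subalgebra.coe_val, ← Polynomial.aeval_algHom_apply] at this
  refine eq_zero_of_trace_mul_centralizer_eq_zero hsimple haX fun b hb => ?_
  exact (Matrix.isNilpotent_trace_of_isNilpotent
    ((hcomm b hb).isNilpotent_mul_right hnil)).eq_zero

/-- Traces against a basis `t` made of central elements give an injective, hence antilipschitz,
linear map on the span. At a central z its coordinates are traces of central elements, so of modulus
at most `n`. -/
theorem exists_norm_centerMatrices_le (hconn : IsConnected (G : Set (GL (Fin n) ℂ)))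
    (hsimple : LieAlgebra.IsSimple ℝ (lieAlgebra G hG)) :
    ∃ K : ℝ, ∀ z ∈ centerMatrices G, ‖z‖ ≤ K := by
  obtain ⟨t, ht, -, hspan, -⟩ := Submodule.exists_finset_span_eq_linearIndepOn ℂ
    (centerMatrices G : Set (Matrix (Fin n) (Fin n) ℂ))
  let f : Submodule.span ℂ (centerMatrices G : Set (Matrix (Fin n) (Fin n) ℂ)) →ₗ[ℂ] (t → ℂ) :=
    { toFun := fun a i => ((a : Matrix (Fin n) (Fin n) ℂ) * i).trace
      map_add' := fun a b => by ext; simp [add_mul]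
      map_smul' := fun c a => by ext; simp }
  have hker : LinearMap.ker f = ⊥ := by
    rw [LinearMap.ker_eq_bot']
    intro a haf
    refine Subtype.ext (eq_zero_of_mem_span_centerMatrices hconn hsimple a.2 fun z hz => ?_)
    have hz' : z ∈ Submodule.span ℂ (t : Set (Matrix (Fin n) (Fin n) ℂ)) := by
      rw [hspan]; exact Submodule.subset_span hz
    clear hz
    induction hz' using Submodule.span_induction with
    | mem y hy => exact congrFun haf ⟨y, hy⟩
    | zero => simp
    | add y z _ _ hy hz => rw [mul_add, Matrix.trace_add, hy, hz, add_zero]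
    | smul c y _ hy => rw [mul_smul_comm, Matrix.trace_smul, hy, smul_zero]
  obtain ⟨K, -, hK⟩ := f.exists_antilipschitzWith hker
  refine ⟨K * n, fun z hz => ?_⟩
  have h := hK.le_mul_norm (map_zero f) ⟨z, Submodule.subset_span hz⟩
  refine h.trans (mul_le_mul_of_nonneg_left ?_ K.2)
  refine (pi_norm_le_iff_of_nonneg n.cast_nonneg).2 fun i => ?_
  exact norm_trace_centerMatrices_le hconn hsimple (mul_mem hz (ht i.2))

end Center

/-! ### The ideal of elements with bounded adjoint orbit. -/

section BoundedOrbits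

variable {A : Type*} [NormedRing A] [NormedAlgebra ℝ A] [CompleteSpace A] {G : Subgroup Aˣ}
  {hG : IsClosed (G : Set Aˣ)}

/-- The Lie algebra of a closed subgroup of the units of a Banach algebra. -/
def lieSubalgebra (hG : IsClosed (G : Set Aˣ)) : LieSubalgebra ℝ A where
  toSubmodule := oneParamSubmodule G hG
  lie_mem' := fun hX hY => lie_mem_oneParam G hG hX hY

theorem eq_zero_of_commutator_eq_zero [LieAlgebra.HasTrivialRadical ℝ (lieSubalgebra hG)]
    {Y : LieAlg G hG} (hY : ∀ x, commutator hG Y x = 0) : Y = 0 := by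
  have h : (⟨incl hG Y, incl_mem Y⟩ : lieSubalgebra hG) ∈
      LieAlgebra.center ℝ (lieSubalgebra hG) := fun x => by
    rw [← lie_skew, neg_eq_zero]
    exact Subtype.ext (congrArg (incl hG) (hY (LieAlg.mk hG x x.2)))
  rw [LieAlgebra.center_eq_bot, LieSubmodule.mem_bot] at h
  exact LieAlg.ext (congrArg Subtype.val h)

theorem exists_eq_commutator_of_leibniz [FiniteDimensional ℝ A]
    [LieAlgebra.IsKilling ℝ (lieSubalgebra hG)] (D : LieAlg G hG →ₗ[ℝ] LieAlg G hG)
    (hD : ∀ x y, D (commutator hG x y) = commutator hG (D x) y + commutator hG x (D y)) :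
    ∃ Y, ∀ x, D x = commutator hG Y x := by
  let D' : LieDerivation ℝ (lieSubalgebra hG) (lieSubalgebra hG) :=
    { toFun := fun x => ⟨incl hG (D (LieAlg.mk hG x x.2)), incl_mem _⟩
      map_add' := fun x y => Subtype.ext <| by
        have : LieAlg.mk hG (x + y : lieSubalgebra hG) (x + y).2 =
          LieAlg.mk hG x x.2 + LieAlg.mk hG y y.2 := rfl
        change incl hG (D _) = incl hG (D _) + incl hG (D _)
        rw [this, map_add, map_add]
      map_smul' := fun c x => Subtype.ext <| by
        have : LieAlg.mk hG (c • x : lieSubalgebra hG) (c • x).2 =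
          c • LieAlg.mk hG x x.2 := rfl
        change incl hG (D _) = c • incl hG (D _)
        rw [this, map_smul, map_smul]
      leibniz' := fun x y => Subtype.ext <| by
        have h := congrArg (incl hG) (hD (LieAlg.mk hG x x.2) (LieAlg.mk hG y y.2))
        rw [map_add] at h
        have key : ∀ a b c d : A, (a * b - b * a) + (c * d - d * c) =
          (c * d - d * c) - (b * a - a * b) := fun a b c d => by abel
        exact h.trans (key (incl hG (D (LieAlg.mk hG x x.2))) y x
          (incl hG (D (LieAlg.mk hG y y.2)))) }
  obtain ⟨Y, hY⟩ := LieDerivation.IsKilling.exists_eq_ad D'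
  refine ⟨LieAlg.mk hG Y Y.2, fun x => LieAlg.ext ?_⟩
  have h : D' ⟨incl hG x, incl_mem x⟩ = ⁅Y, (⟨incl hG x, incl_mem x⟩ : lieSubalgebra hG)⁆ := by
    rw [← hY]
    exact congrArg (fun E : lieSubalgebra hG →ₗ[ℝ] lieSubalgebra hG => E ⟨incl hG x, incl_mem x⟩)
      (LieDerivation.coe_ad_apply_eq_ad_apply Y)
  exact congrArg Subtype.val h

/-- The elements of the Lie algebra with bounded adjoint orbit. -/
def boundedOrbitSubmodule (hG : IsClosed (G : Set Aˣ)) :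
    Submodule ℝ (A) where
  carrier := {X | X ∈ oneParam G ∧ ∃ C : ℝ, ∀ u ∈ G,
    ‖(u : A) * X * ((u⁻¹ : Aˣ) : A)‖ ≤ C}
  zero_mem' := ⟨zero_mem_oneParam G, 0, fun u _ => by simp⟩
  add_mem' := by
    rintro X Y ⟨hX, C, hC⟩ ⟨hY, D, hD⟩
    refine ⟨add_mem_oneParam G hG hX hY, C + D, fun u hu => ?_⟩
    rw [mul_add, add_mul]
    exact (norm_add_le _ _).trans (add_le_add (hC u hu) (hD u hu))
  smul_mem' := by
    rintro c X ⟨hX, C, hC⟩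
    refine ⟨smul_mem_oneParam G c hX, ‖c‖ * C, fun u hu => ?_⟩
    rw [mul_smul_comm, smul_mul_assoc, norm_smul]
    exact mul_le_mul_of_nonneg_left (hC u hu) (norm_nonneg c)

variable [FiniteDimensional ℝ A]

/-- The bracket is the derivative at 0 of Ad(exp(sX))Y, a curve in a subspace that is stable under
`G` and closed by finite dimension. -/
theorem lie_mem_boundedOrbitSubmodule {X Y : A} (hX : X ∈ oneParam G)
    (hY : Y ∈ boundedOrbitSubmodule hG) : X * Y - Y * X ∈ boundedOrbitSubmodule hG := by
  have hd : HasDerivAt (fun s : ℝ => NormedSpace.exp (s • X) * Y * NormedSpace.exp (s • (-X)))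
      (X * Y - Y * X) 0 := by
    have h := ((hasDerivAt_exp_smul_const (𝕂 := ℝ) X (0 : ℝ)).mul_const Y).mul
      (hasDerivAt_exp_smul_const (𝕂 := ℝ) (-X) (0 : ℝ))
    refine h.congr_deriv ?_
    simp [sub_eq_add_neg]
  have hmem : ∀ s : ℝ, NormedSpace.exp (s • X) * Y * NormedSpace.exp (s • (-X)) ∈
      boundedOrbitSubmodule hG := by
    intro s
    obtain ⟨u, hu, hus⟩ := hX s
    obtain ⟨hY1, C, hC⟩ := hY
    have hinv : ((u⁻¹ : Aˣ) : A) = NormedSpace.exp (s • (-X)) := by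
      rw [smul_neg]; exact inv_eq_exp_neg hus
    have hu' : (u : A) * Y *
        ((u⁻¹ : Aˣ) : A) ∈ boundedOrbitSubmodule hG := by
      refine ⟨conj_mem_oneParam G hu hY1, C, fun v hv => ?_⟩
      have := hC (v * u) (G.mul_mem hv hu)
      simpa [mul_assoc] using this
    rw [hinv] at hu'
    exact (congrArg (fun a => a * Y * NormedSpace.exp (s • (-X)) ∈ boundedOrbitSubmodule hG)
      hus).mp hu'
  refine (Submodule.closed_of_finiteDimensional (boundedOrbitSubmodule hG)).mem_of_tendsto
    (hasDerivAt_iff_tendsto_slope.1 hd) (Filter.Eventually.of_forall fun s => ?_)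
  simp only [slope, vsub_eq_sub]
  exact Submodule.smul_mem _ _ (Submodule.sub_mem _ (hmem s) (hmem 0))

theorem oneParam_subset_boundedOrbitSubmodule
    (hsimple : LieAlgebra.IsSimple ℝ (lieSubalgebra hG)) {x : A}
    (hx : x ∈ boundedOrbitSubmodule hG) (hx0 : x ≠ 0) :
    oneParam G ⊆ boundedOrbitSubmodule hG := by
  let I : LieIdeal ℝ (lieSubalgebra hG) :=
    { (boundedOrbitSubmodule hG).comap (lieSubalgebra hG).toSubmodule.subtype with
      lie_mem := fun {y m} hm => lie_mem_boundedOrbitSubmodule (hG := hG) y.2 hm }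
  have hxI : (⟨x, hx.1⟩ : lieSubalgebra hG) ∈ I := hx
  rcases LieAlgebra.IsSimple.eq_bot_or_eq_top (R := ℝ) I with h | h
  · rw [h, LieSubmodule.mem_bot] at hxI
    exact absurd (congrArg Subtype.val hxI) hx0
  · intro y hy
    have : (⟨y, hy⟩ : lieSubalgebra hG) ∈ I := h ▸ trivial
    exact this

theorem exists_norm_Ad_le (hsub : oneParam G ⊆ boundedOrbitSubmodule hG) :
    ∃ C : ℝ, ∀ u : G, ‖Ad hG u‖ ≤ C := by
  have _ : CompleteSpace (LieAlg G hG) := FiniteDimensional.complete ℝ _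
  refine banach_steinhaus fun x => ?_
  obtain ⟨-, C, hC⟩ := hsub (incl_mem x)
  exact ⟨C, fun u => hC u u.2⟩

theorem exists_bound_mul_center_of_isSimple (hconn : IsConnected (G : Set Aˣ))
    (hsimple : LieAlgebra.IsSimple ℝ (lieSubalgebra hG)) {x : A}
    (hx : x ∈ boundedOrbitSubmodule hG) (hx0 : x ≠ 0) :
    ∃ K : ℝ, ∀ u ∈ G, ∃ v ∈ G, ∃ z ∈ G, u = v * z ∧ ‖(v : A)‖ ≤ K ∧
      ∀ w ∈ G, Commute (z : A) w := by
  obtain ⟨C, hC⟩ := exists_norm_Ad_le (oneParam_subset_boundedOrbitSubmodule hsimple hx hx0)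
  -- A simple real Lie algebra has nondegenerate Killing form and zero centre, so its derivations
  -- are inner and ad is injective.
  exact exists_bound_mul_center hconn exists_eq_commutator_of_leibniz
    (fun _ => eq_zero_of_commutator_eq_zero) hC

end BoundedOrbits

/-! ### From a trivial limit to a bounded orbit, and to compactness. -/

section Main

open scoped Matrix.Norms.Operator

variable {n : ℕ} {G : Subgroup (GL (Fin n) ℂ)} {hG : IsClosed (G : Set (GL (Fin n) ℂ))}

theorem isCompact_of_mem_boundedOrbitSubmodule (hconn : IsConnected (G : Set (GL (Fin n) ℂ)))
    (hsimple : LieAlgebra.IsSimple ℝ (lieAlgebra G hG)) {x : Matrix (Fin n) (Fin n) ℂ}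
    (hx : x ∈ boundedOrbitSubmodule hG) (hx0 : x ≠ 0) : IsCompact (G : Set (GL (Fin n) ℂ)) := by
  obtain ⟨K, hK⟩ := exists_bound_mul_center_of_isSimple hconn hsimple hx hx0
  obtain ⟨Kz, hKz⟩ := exists_norm_centerMatrices_le hconn hsimple
  refine isCompact_of_forall_norm_le hG (K := K * Kz) fun u hu => ?_
  obtain ⟨v, hv, z, hz, rfl, hvK, hzc⟩ := hK u hu
  rw [Units.val_mul]
  exact (norm_mul_le _ _).trans (mul_le_mul hvK (hKz _ ⟨z, hz, rfl, hzc⟩) (norm_nonneg _)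
    ((norm_nonneg _).trans hvK))

/-- If the rescaled orbits of `x` accumulate only at zero, then the orbit of `x` is bounded. -/
theorem mem_boundedOrbitSubmodule_of_orbitLimit_eq {x : lieAlgebra G hG}
    (hlim : orbitLimit hG x = {0}) :
    (x : Matrix (Fin n) (Fin n) ℂ) ∈ boundedOrbitSubmodule hG := by
  refine ⟨x.2, ?_⟩
  by_contra! hcon
  choose u hu hlt using fun k : ℕ => hcon ((k : ℝ) + 1)
  set r : ℕ → ℝ := fun k => ‖(u k : Matrix (Fin n) (Fin n) ℂ) * x *
    (((u k)⁻¹ : GL (Fin n) ℂ) : Matrix (Fin n) (Fin n) ℂ)‖ with hr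
  have hrpos : ∀ k, 0 < r k := fun k => lt_trans (by positivity) (hlt k)
  -- Orbit points of norm `r k` tending to infinity, scaled to the unit sphere: `y k` lies in the
  -- orbit of νx with ν = 1 / `r k` → 0.
  let y : ℕ → lieAlgebra G hG := fun k => adjoint hG ⟨u k, hu k⟩ ((r k)⁻¹ • x)
  have hy : ∀ k, (y k : Matrix (Fin n) (Fin n) ℂ) = (r k)⁻¹ •
      ((u k : Matrix (Fin n) (Fin n) ℂ) * x *
        (((u k)⁻¹ : GL (Fin n) ℂ) : Matrix (Fin n) (Fin n) ℂ)) := fun k => by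
    rw [← smul_mul_assoc, ← mul_smul_comm]; rfl
  have hnorm : ∀ k, (y k : Matrix (Fin n) (Fin n) ℂ) ∈
      Metric.sphere (0 : Matrix (Fin n) (Fin n) ℂ) 1 := fun k => by
    rw [mem_sphere_zero_iff_norm, hy, norm_smul, norm_inv, Real.norm_of_nonneg (hrpos k).le]
    exact inv_mul_cancel₀ (hrpos k).ne'
  have _ : ProperSpace (Matrix (Fin n) (Fin n) ℂ) := FiniteDimensional.proper ℝ _
  obtain ⟨w, hw1, φ, hφ, hw⟩ := (isCompact_sphere
    (0 : Matrix (Fin n) (Fin n) ℂ) 1).tendsto_subseq hnorm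
  have hwG : w ∈ oneParam G := (isClosed_oneParam G hG).mem_of_tendsto hw
    (Filter.Eventually.of_forall fun k => (y (φ k)).2)
  have hw' : Filter.Tendsto (fun k => y (φ k)) Filter.atTop (𝓝 (⟨w, hwG⟩ : lieAlgebra G hG)) :=
    tendsto_subtype_rng.2 hw
  have hmem : (⟨w, hwG⟩ : lieAlgebra G hG) ∈ orbitLimit hG x := by
    refine Set.mem_iInter₂.2 fun ε hε => ?_
    refine mem_closure_of_tendsto hw' ?_
    have hev : ∀ᶠ k : ℕ in Filter.atTop, 1 / ((φ k : ℝ) + 1) < ε :=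
      (tendsto_one_div_add_atTop_nhds_zero_nat.comp hφ.tendsto_atTop).eventually (gt_mem_nhds hε)
    filter_upwards [hev] with k hk
    refine Set.mem_iUnion₂.2 ⟨(r (φ k))⁻¹, ⟨inv_pos.2 (hrpos _), ?_⟩, ⟨⟨u (φ k), hu _⟩, rfl⟩⟩
    refine lt_trans ?_ hk
    rw [one_div]
    exact inv_strictAnti₀ (by positivity) (hlt _)
  rw [hlim, Set.mem_singleton_iff] at hmem
  have hw0 : w = 0 := congrArg Subtype.val hmem
  rw [hw0] at hw1
  simp at hw1

end Main

end LinearGroup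

theorem theorem5p1 (n : ℕ) (G : Subgroup (GL (Fin n) ℂ))
    (hG : IsClosed (G : Set (GL (Fin n) ℂ)))
    (hconn : IsConnected (G : Set (GL (Fin n) ℂ)))
    (hnoncompact : ¬ IsCompact (G : Set (GL (Fin n) ℂ)))
    (hsimple : LieAlgebra.IsSimple ℝ (LinearGroup.lieAlgebra G hG))
    (x : LinearGroup.lieAlgebra G hG) (hx : x ≠ 0) :
    LinearGroup.orbitLimit hG x ≠ {0} := by
  intro hlim
  exact hnoncompact (LinearGroup.isCompact_of_mem_boundedOrbitSubmodule hconn hsimple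
    (LinearGroup.mem_boundedOrbitSubmodule_of_orbitLimit_eq hlim) fun h => hx (Subtype.ext h))
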